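/- Let $X$ be a complex unital Banach algebra, $x\in X$, and $R_x(\lambda)=(\lambda-x)^{-1}$ for $\lambda\notin\sigma(x)$. A function $F$ with values in $X$ is Dunford integrable with respect to a measure $\mu$ if $\Lambda\circ F\in L^1(\mu)$ for every $\Lambda\in X^*$; its Dunford integral $D\!\int F\,d\mu\in X^{**}$ is $\Lambda\mapsto\int\Lambda\circ F\,d\mu$. Let $\ell$ be Lebesgue measure on $\mathbb C$. Assume that $x$ is regular, that is, $R_x$ is Dunford integrable on $(\Omega\setminus\sigma(x),\ell)$ for every precompact open neighbourhood $\Omega$ of $\sigma(x)$. Let $f$ be a $C^\infty$ complex function on a precompact open neighbourhood $U$ of $\sigma(x)$. For a bounded open set $\omega\subset\mathbb C$ with $C^\infty$ boundary, not necessarily connected, let $\int_{\partial\omega}g\,dz$ be the contour integral along $\partial\omega$ oriented positively (with $\omega$ on the left), i.e. $dz=\tau\,ds$ with $\tau$ the positive unit tangent and $ds$ arc length. Call $\omega$ admissible if $\sigma(x)\subset\omega$ and $\overline\omega\subset U$. For admissible $\omega$ put, with $\partial_{z^*}=\frac12(\partial_x+i\partial_y)$, $$f(x)=\frac1{2\pi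 i}\,D\!\!\int_{\partial\omega}f\,R_x\,dz-\frac1\pi\,D\!\!\int_{\omega\setminus\sigma(x)}\partial_{z^*}f\;R_x\,d\ell\ \in X^{**}.$$ Let $H:\mathbb C\to[0,\infty)$ be a $C^\infty$ function with $H^{-1}(\{0\})=\sigma(x)$ for which $\{H<\delta\}$ is bounded for some $\delta>0$, and let $t_n>0$ be regular values of $H$ with $t_n\to0$. Put $\Omega_n=\{H<t_n\}$ and $\gamma_n=H^{-1}(\{t_n\})$. Then, for all sufficiently large $n$, $\Omega_n$ is admissible and $\gamma_n=\partial\Omega_n$. For every admissible $\omega$, both Dunford integrals defining $f(x)$ exist, and for every $\Lambda\in X^*$ the limit below exists and $$\Lambda(f(x))=\frac1{2\pi i}\lim_{n\to\infty}\int_{\gamma_n}f\;(\Lambda\circ R_x)\,dz,$$ where $\gamma_n$ is oriented as $\partial\Omega_n$ and $\Lambda(f(x))$ denotes $f(x)(\Lambda)$. In particular $f(x)$ does not depend on $\omega$. -/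

import Mathlib

open MeasureTheory Filter Topology
open scoped ContDiff

noncomputable section

namespace SmoothCalculus

/-! Dunford integration of functions with values in a complex Banach space. -/

section Dunford

variable {α : Type*} [MeasurableSpace α] {X : Type*} [NormedAddCommGroup X] [NormedSpace ℂ X]

/-- `F` is scalarly (Dunford) integrable with respect to `μ`: `Λ ∘ F ∈ L¹(μ)` for every
continuous linear functional `Λ`. -/
def DunfordIntegrable (F : α → X) (μ : Measure α) : Prop :=
  ∀ Λ : StrongDual ℂ X, Integrable (fun a => Λ (F a)) μ

/-- The linear map `Λ ↦ Λ ∘ F` from the dual space to `L¹(μ)`. -/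
def dunfordToL1 {F : α → X} {μ : Measure α} (hF : DunfordIntegrable F μ) :
    StrongDual ℂ X →ₗ[ℂ] (α →₁[μ] ℂ) where
  toFun Λ := (hF Λ).toL1 _
  map_add' Λ Φ := Integrable.toL1_add _ _ (hF Λ) (hF Φ)
  map_smul' c Λ := Integrable.toL1_smul _ (hF Λ) c

/-- Dunford's lemma, in its `L¹` form: a consequence of the closed graph theorem. -/
theorem continuous_dunfordToL1 {F : α → X} {μ : Measure α} (hF : DunfordIntegrable F μ) :
    Continuous (dunfordToL1 hF) := by
  refine LinearMap.continuous_of_seq_closed_graph _ ?_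
  intro u Λ g hu hg
  have hm : TendstoInMeasure μ (fun n => ((dunfordToL1 hF ∘ u) n : α → ℂ)) atTop g :=
    tendstoInMeasure_of_tendsto_Lp hg
  obtain ⟨ns, hns, hae⟩ := hm.exists_seq_tendsto_ae
  have hcoe : ∀ᵐ a ∂μ, ∀ n, ((dunfordToL1 hF (u n) : α →₁[μ] ℂ) : α → ℂ) a = u n (F a) := by
    rw [ae_all_iff]
    intro n
    exact (hF (u n)).coeFn_toL1
  have hcoe' : ((dunfordToL1 hF Λ : α →₁[μ] ℂ) : α → ℂ) =ᵐ[μ] fun a => Λ (F a) :=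
    (hF Λ).coeFn_toL1
  refine Lp.ext ?_
  filter_upwards [hae, hcoe, hcoe'] with a h1 h2 h3
  rw [h3]
  refine tendsto_nhds_unique h1 ?_
  have h4 : Tendsto (fun i => u (ns i) (F a)) atTop (𝓝 (Λ (F a))) :=
    (((ContinuousLinearMap.apply ℂ ℂ (F a)).continuous.tendsto Λ).comp hu).comp
      hns.tendsto_atTop
  simpa only [Function.comp_apply, h2] using h4

/-- Dunford's lemma. -/
theorem continuous_integral_dual {F : α → X} {μ : Measure α} (hF : DunfordIntegrable F μ) :
    Continuous fun Λ : StrongDual ℂ X => ∫ a, Λ (F a) ∂μ :=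
  (continuous_integral.comp (continuous_dunfordToL1 hF)).congr fun Λ =>
    integral_congr_ae (hF Λ).coeFn_toL1

open Classical in
/-- The Dunford integral of `F` with respect to `μ`: the element `Λ ↦ ∫ Λ ∘ F dμ` of the bidual
(and `0` if `F` is not Dunford integrable). -/
def dunfordIntegral (F : α → X) (μ : Measure α) : StrongDual ℂ (StrongDual ℂ X) :=
  if hF : DunfordIntegrable F μ then
    { toFun := fun Λ => ∫ a, Λ (F a) ∂μ
      map_add' := fun Λ Φ => integral_add (hF Λ) (hF Φ)
      map_smul' := fun c Λ => integral_const_mul c fun a => Λ (F a)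
      cont := continuous_integral_dual hF }
  else 0

theorem dunfordIntegral_apply {F : α → X} {μ : Measure α} (hF : DunfordIntegrable F μ)
    (Λ : StrongDual ℂ X) : dunfordIntegral F μ Λ = ∫ a, Λ (F a) ∂μ := by
  rw [dunfordIntegral, dif_pos hF]
  rfl

end Dunford

/-! Plane domains with smooth boundary and the contour integral along their boundary. -/

/-- Near the boundary point `p`, the set `D` is the sublevel set `{ρ < 0}` of a smooth function
`ρ` with `ρ p = 0` and `∇ρ(p) ≠ 0`. -/
def IsLocalDefiningFunction (D : Set ℂ) (p : ℂ) (ρ : ℂ → ℝ) : Prop :=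
  ρ p = 0 ∧ gradient ρ p ≠ 0 ∧
    ∃ V : Set ℂ, IsOpen V ∧ p ∈ V ∧ ContDiffOn ℝ ∞ ρ V ∧ ∀ z ∈ V, z ∈ D ↔ ρ z < 0

/-- `D` is a bounded open subset of the plane with smooth boundary. It need not be connected, so
that `∂D` may consist of several closed curves. -/
structure IsSmoothDomain (D : Set ℂ) : Prop where
  isOpen : IsOpen D
  isBounded : Bornology.IsBounded D
  smooth_boundary : ∀ p ∈ frontier D, ∃ ρ : ℂ → ℝ, IsLocalDefiningFunction D p ρ

open Classical in
/-- The outer unit normal `∇ρ / |∇ρ|` of `D` at the boundary point `p`, where `ρ` is any local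
defining function; see `outerNormal_eq` for the independence of `ρ`. -/
def outerNormal (D : Set ℂ) (p : ℂ) : ℂ :=
  if h : ∃ ρ : ℂ → ℝ, IsLocalDefiningFunction D p ρ then
    (‖gradient h.choose p‖⁻¹ : ℝ) • gradient h.choose p
  else 0

/-- Two local defining functions at the same point: a direction along which the first one decreases
is a direction along which the second one does not increase. -/
theorem inner_gradient_nonpos {D : Set ℂ} {p : ℂ} {ρ₁ ρ₂ : ℂ → ℝ}
    (h₁ : IsLocalDefiningFunction D p ρ₁) (h₂ : IsLocalDefiningFunction D p ρ₂) (v : ℂ)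
    (hv : inner ℝ (gradient ρ₁ p) v < 0) : inner ℝ (gradient ρ₂ p) v ≤ 0 := by
  obtain ⟨h10, -, V₁, hV₁, hp₁, hs₁, hD₁⟩ := h₁
  obtain ⟨h20, -, V₂, hV₂, hp₂, hs₂, hD₂⟩ := h₂
  have key : ∀ (ρ : ℂ → ℝ) (V : Set ℂ), IsOpen V → p ∈ V → ContDiffOn ℝ ∞ ρ V →
      HasDerivAt (fun s : ℝ => ρ (p + s • v)) (inner ℝ (gradient ρ p) v) 0 := by
    intro ρ V hV hp hs
    have hd : DifferentiableAt ℝ ρ p :=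
      (hs.contDiffAt (hV.mem_nhds hp)).differentiableAt (by simp)
    have hl : HasDerivAt (fun s : ℝ => p + s • v) v 0 := by
      simpa using ((hasDerivAt_id (0 : ℝ)).smul_const v).const_add p
    have hg := hd.hasGradientAt.hasFDerivAt
    have hg' : HasFDerivAt ρ (InnerProductSpace.toDual ℝ ℂ (gradient ρ p))
        (p + (0 : ℝ) • v) := by simpa using hg
    have hc := hg'.comp_hasDerivAt (0 : ℝ) hl
    rw [InnerProductSpace.toDual_apply_apply] at hc
    exact hc
  have k₁ := key ρ₁ V₁ hV₁ hp₁ hs₁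
  have k₂ := key ρ₂ V₂ hV₂ hp₂ hs₂
  by_contra! hpos
  have hcont : Tendsto (fun s : ℝ => p + s • v) (𝓝[>] 0) (𝓝 p) := by
    have : Continuous fun s : ℝ => p + s • v := by fun_prop
    simpa using (this.tendsto 0).mono_left nhdsWithin_le_nhds
  have e₁ : ∀ᶠ s in 𝓝[>] (0 : ℝ), ρ₁ (p + s • v) < 0 := by
    have := (hasDerivWithinAt_iff_tendsto_slope' (by simp)).1 (k₁.hasDerivWithinAt (s := Set.Ioi 0))
    filter_upwards [this.eventually_lt_const hv, self_mem_nhdsWithin] with s hs hs0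
    have hs0' : (0 : ℝ) < s := hs0
    simp only [slope_def_field, zero_smul, add_zero, h10, sub_zero] at hs
    by_contra! hc
    exact absurd hs (not_lt.2 (div_nonneg hc hs0'.le))
  have e₂ : ∀ᶠ s in 𝓝[>] (0 : ℝ), 0 < ρ₂ (p + s • v) := by
    have := (hasDerivWithinAt_iff_tendsto_slope' (by simp)).1 (k₂.hasDerivWithinAt (s := Set.Ioi 0))
    filter_upwards [this.eventually_const_lt hpos, self_mem_nhdsWithin] with s hs hs0
    have hs0' : (0 : ℝ) < s := hs0
    simp only [slope_def_field, zero_smul, add_zero, h20, sub_zero] at hs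
    by_contra! hc
    exact absurd hs (not_lt.2 (div_nonpos_of_nonpos_of_nonneg hc hs0'.le))
  obtain ⟨s, hs₁, hs₂, hm₁, hm₂⟩ := (e₁.and (e₂.and ((hcont.eventually_mem (hV₁.mem_nhds hp₁)).and
    (hcont.eventually_mem (hV₂.mem_nhds hp₂))))).exists
  exact absurd ((hD₂ _ hm₂).1 ((hD₁ _ hm₁).2 hs₁)) (not_lt.2 hs₂.le)

/-- The outer unit normal does not depend on the local defining function. -/
theorem outerNormal_eq {D : Set ℂ} {p : ℂ} {ρ : ℂ → ℝ} (h : IsLocalDefiningFunction D p ρ) :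
    outerNormal D p = (‖gradient ρ p‖⁻¹ : ℝ) • gradient ρ p := by
  have hex : ∃ ρ : ℂ → ℝ, IsLocalDefiningFunction D p ρ := ⟨ρ, h⟩
  rw [outerNormal, dif_pos hex]
  have ha := hex.choose_spec.2.1
  have hb := h.2.1
  have himp := inner_gradient_nonpos hex.choose_spec h
  generalize gradient hex.choose p = a at ha himp ⊢
  generalize gradient ρ p = b at hb himp ⊢
  have ha' : 0 < ‖a‖ := norm_pos_iff.2 ha
  have hb' : 0 < ‖b‖ := norm_pos_iff.2 hb
  have hle := real_inner_le_norm a b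
  have h1 : inner ℝ a ((‖a‖ : ℝ) • b - (‖b‖ : ℝ) • a) = ‖a‖ * (inner ℝ a b - ‖a‖ * ‖b‖) := by
    rw [inner_sub_right, inner_smul_right, inner_smul_right, real_inner_self_eq_norm_sq]; ring
  have h2 : inner ℝ b ((‖a‖ : ℝ) • b - (‖b‖ : ℝ) • a) = ‖b‖ * (‖a‖ * ‖b‖ - inner ℝ a b) := by
    rw [inner_sub_right, inner_smul_right, inner_smul_right, real_inner_self_eq_norm_sq,
      real_inner_comm a b]; ring
  have heq : inner ℝ a b = ‖a‖ * ‖b‖ := by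
    refine le_antisymm hle ?_
    by_contra! hlt
    have := himp _ (by rw [h1]; exact mul_neg_of_pos_of_neg ha' (by linarith))
    rw [h2] at this
    exact absurd this (not_le.2 (mul_pos hb' (by linarith)))
  have hs := inner_eq_norm_mul_iff_real.1 heq
  rw [inv_smul_eq_iff₀ ha'.ne', smul_comm, eq_inv_smul_iff₀ hb'.ne']
  exact hs

/-- The positively oriented unit tangent of `∂D` at `p`: the outer unit normal rotated
counterclockwise by a right angle, so that `D` lies to the left. -/
def unitTangent (D : Set ℂ) (p : ℂ) : ℂ := Complex.I * outerNormal D p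

/-- The contour integral `∫_{∂D} g dz` over the positively oriented boundary of `D`. The line
element is `dz = τ ds`, with `τ` the positive unit tangent and `ds` the arc length, i.e. the
one-dimensional Hausdorff measure on `∂D`. -/
def contourIntegral (D : Set ℂ) (g : ℂ → ℂ) : ℂ :=
  ∫ z in frontier D, g z * unitTangent D z ∂(μH[1] : Measure ℂ)

/-- The Wirtinger derivative `∂f/∂z* = (∂f/∂x + i ∂f/∂y) / 2`. -/
def dbar (f : ℂ → ℂ) (z : ℂ) : ℂ :=
  (fderiv ℝ f z 1 + Complex.I * fderiv ℝ f z Complex.I) / 2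

/-! Regular elements and the smooth functional calculus. -/

section Calculus

variable {X : Type*} [NormedRing X] [NormedAlgebra ℂ X]

/-- `x` is regular: the resolvent function `λ ↦ (λ - x)⁻¹` is Dunford integrable on `Ω \ σ(x)` for
every precompact open neighbourhood `Ω` of `σ(x)`. -/
def IsRegularElement (x : X) : Prop :=
  ∀ Ω : Set ℂ, IsOpen Ω → IsCompact (closure Ω) → spectrum ℂ x ⊆ Ω →
    DunfordIntegrable (fun z : ℂ => resolvent x z)
      ((volume : Measure ℂ).restrict (Ω \ spectrum ℂ x))

/-- `f` belongs to `C^∞(x)`, with domain `U`: it is a smooth function on the precompact open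
neighbourhood `U` of `σ(x)`. -/
structure IsSmoothNearSpectrum (x : X) (f : ℂ → ℂ) (U : Set ℂ) : Prop where
  isOpen : IsOpen U
  isCompact_closure : IsCompact (closure U)
  spectrum_subset : spectrum ℂ x ⊆ U
  contDiffOn : ContDiffOn ℝ ∞ f U

/-- The contour `γ = ∂D`, with `int γ = D`, is admissible for functions with domain `U`: it is
smooth, it surrounds `σ(x)`, and it is contained in `U` together with its interior. -/
structure IsAdmissible (x : X) (U D : Set ℂ) : Prop where
  isSmoothDomain : IsSmoothDomain D
  spectrum_subset : spectrum ℂ x ⊆ D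
  closure_subset : closure D ⊆ U

/-- The integrand of `∫_{∂D} f(z) R_x(z) dz` as a density with respect to arc length. -/
def contourIntegrand (x : X) (f : ℂ → ℂ) (D : Set ℂ) (z : ℂ) : X :=
  (f z * unitTangent D z) • resolvent x z

/-- The integrand `∂f/∂z* (z) R_x(z)` of the area integral. -/
def areaIntegrand (x : X) (f : ℂ → ℂ) (z : ℂ) : X :=
  dbar f z • resolvent x z

/-- The element `f(x)` of the bidual given by the smooth functional calculus, computed along the
contour `γ = ∂D`:
`f(x) = (1/2πi) ∫_{∂D} f R_x dz - (1/π) ∫_{D \ σ(x)} (∂f/∂z*) R_x dℓ`. -/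
def smoothCalculus (x : X) (f : ℂ → ℂ) (D : Set ℂ) : StrongDual ℂ (StrongDual ℂ X) :=
  (1 / (2 * (Real.pi : ℂ) * Complex.I)) •
      dunfordIntegral (contourIntegrand x f D) ((μH[1] : Measure ℂ).restrict (frontier D)) -
    (1 / (Real.pi : ℂ)) •
      dunfordIntegral (areaIntegrand x f)
        ((volume : Measure ℂ).restrict (D \ spectrum ℂ x))

end Calculus

end SmoothCalculus

end

/-! Fix `Λ` and write `h = Λ ∘ R_x`, which is holomorphic off `σ(x)`, so that `∂(f h)/∂z* = (∂f/∂z*)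
h` there. Let `D` be admissible. Since `Ω_n` shrinks to `σ(x)`, its closure lies in `D` for large
`n`, and Stokes' theorem on `D \ Ω_n` gives `∫_{γ_n} f h dz = ∫_{∂D} f h dz - 2i ∫_{D \ Ω_n}
(∂f/∂z*) h dℓ`. By regularity `h` is integrable on `D \ σ(x)`, and `∂f/∂z*` is bounded on `D`, so by
dominated convergence the area integral tends to the one over `D \ σ(x)`. Division by `2πi` turns
the right side into `Λ(f(x))`; the left side does not involve `D`, whence the independence of the
contour.

The work lies in Stokes' theorem for boundaries measured by `μH[1]` (`IsSmoothDomain.hasStokes`).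
Its ingredients are the arc length formula (`hausdorffMeasure_restrict_range_eq_map`), Stokes below
a graph by Fubini (`integral_dbar_below_graph`), graph charts of the boundary from the implicit
function theorem (`IsLocalDefiningFunction.exists_graph`), and a patching of cutoffs.
`IsAdmissible.contourIntegral_eq` then treats two nested contours, and
`tendsto_setIntegral_diff_sublevel` takes the limit. -/

noncomputable section

namespace SmoothCalculus

open scoped Manifold

/-! The one-dimensional Hausdorff measure on a regular curve. -/

section Curve

variable {E : Type*} [NormedAddCommGroup E] [MeasurableSpace E] [BorelSpace E]

theorem hausdorffMeasure_image_le_of_norm_le {γ : ℝ → E} {A : Set ℝ} {c : ℝ}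
    (h : ∀ s ∈ A, ∀ t ∈ A, ‖γ s - γ t‖ ≤ c * |s - t|) :
    μH[1] (γ '' A) ≤ ENNReal.ofReal c * volume A := by
  have hl : LipschitzOnWith c.toNNReal γ A :=
    LipschitzOnWith.of_dist_le_mul fun s hs t ht => by
      rw [dist_eq_norm, Real.dist_eq]
      exact (h s hs t ht).trans (by gcongr; exact Real.le_coe_toNNReal c)
  have := hl.hausdorffMeasure_image_le zero_le_one
  rwa [ENNReal.rpow_one, hausdorffMeasure_real] at this

/-- For `c > 0` the inverse of `γ` on `γ '' A` is Lipschitz with constant `c⁻¹`. -/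
theorem le_hausdorffMeasure_image_of_le_norm {γ : ℝ → E} {A : Set ℝ} {c : ℝ}
    (h : ∀ s ∈ A, ∀ t ∈ A, c * |s - t| ≤ ‖γ s - γ t‖) :
    ENNReal.ofReal c * volume A ≤ μH[1] (γ '' A) := by
  rcases le_or_gt c 0 with hc | hc
  · simp [ENNReal.ofReal_of_nonpos hc]
  have hl : AntilipschitzWith (c⁻¹).toNNReal (fun s : A => γ s) :=
    AntilipschitzWith.of_le_mul_dist fun s t => by
      have := h s s.2 t t.2
      rw [Real.coe_toNNReal _ (inv_nonneg.2 hc.le), dist_eq_norm (γ s), Subtype.dist_eq,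
        Real.dist_eq, inv_mul_eq_div, le_div_iff₀ hc]
      linarith
  have h1 := hl.le_hausdorffMeasure_image zero_le_one Set.univ
  have h2 : μH[1] (Set.univ : Set A) = volume A := by
    rw [← (isometry_subtype_coe (s := A)).hausdorffMeasure_image (Or.inl zero_le_one),
      Set.image_univ, Subtype.range_coe, hausdorffMeasure_real]
  have h3 : (fun s : A => γ s) '' Set.univ = γ '' A := by
    rw [Set.image_univ, ← Set.image_eq_range]
  rw [h2, h3, ENNReal.rpow_one] at h1
  calc ENNReal.ofReal c * volume A
      ≤ ENNReal.ofReal c * (ENNReal.ofReal c⁻¹ * μH[1] (γ '' A)) := by gcongr; exact h1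
    _ = μH[1] (γ '' A) := by
      rw [← mul_assoc, ← ENNReal.ofReal_mul hc.le, mul_inv_cancel₀ hc.ne', ENNReal.ofReal_one,
        one_mul]

variable [NormedSpace ℝ E]

/-- Near a point of strict differentiability, a curve scales length by about its speed. -/
theorem exists_hausdorffMeasure_image_bounds {γ : ℝ → E} {v : E} {t₀ : ℝ}
    (hγ : HasStrictDerivAt γ v t₀) {ε : ℝ} (hε : 0 < ε) :
    ∃ δ > 0, ∀ A ⊆ Metric.ball t₀ δ,
      ENNReal.ofReal (‖v‖ - ε) * volume A ≤ μH[1] (γ '' A) ∧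
        μH[1] (γ '' A) ≤ ENNReal.ofReal (‖v‖ + ε) * volume A := by
  have h1 := (hasStrictFDerivAt_iff_isLittleO.1 hγ.hasStrictFDerivAt).bound hε
  obtain ⟨δ, hδ, h2⟩ := Metric.eventually_nhds_iff_ball.1 h1
  have h3 : ∀ s ∈ Metric.ball t₀ δ, ∀ t ∈ Metric.ball t₀ δ,
      ‖γ s - γ t - (s - t) • v‖ ≤ ε * |s - t| := by
    intro s hs t ht
    have := h2 (s, t) (by rw [← ball_prod_same]; exact ⟨hs, ht⟩)
    simpa using this
  refine ⟨δ, hδ, fun A hA => ⟨le_hausdorffMeasure_image_of_le_norm fun s hs t ht => ?_,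
    hausdorffMeasure_image_le_of_norm_le fun s hs t ht => ?_⟩⟩
  all_goals
    have h4 := h3 s (hA hs) t (hA ht)
    have h5 : ‖(s - t) • v‖ = ‖v‖ * |s - t| := by rw [norm_smul, Real.norm_eq_abs, mul_comm]
  · have h6 := norm_sub_norm_le ((s - t) • v) (γ s - γ t)
    rw [norm_sub_rev ((s - t) • v)] at h6
    linarith
  · have h6 := norm_sub_norm_le (γ s - γ t) ((s - t) • v)
    linarith

/-- The arc length formula: on an injective `C¹` curve, the one-dimensional Hausdorff measure is
the image of `‖γ'(s)‖ ds`. -/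
theorem hausdorffMeasure_restrict_range_eq_map {γ : ℝ → E} (hγ : ContDiff ℝ 1 γ)
    (hemb : MeasurableEmbedding γ) :
    (μH[1] : Measure E).restrict (Set.range γ) =
      ((volume : Measure ℝ).withDensity fun s => ENNReal.ofReal ‖deriv γ s‖).map γ := by
  rw [← hemb.map_comap]
  congr 1
  set ν := Measure.comap γ (μH[1] : Measure E) with hν
  have hνA : ∀ A, ν A = μH[1] (γ '' A) := fun A => hemb.comap_apply _ _
  have hstrict : ∀ t, HasStrictDerivAt γ (deriv γ t) t := fun t =>
    hγ.contDiffAt.hasStrictDerivAt one_ne_zero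
  have hcont : Continuous fun s => ‖deriv γ s‖ := (hγ.continuous_deriv le_rfl).norm
  have hfin : IsLocallyFiniteMeasure ν := by
    refine ⟨fun t => ?_⟩
    obtain ⟨δ, hδ, h⟩ := exists_hausdorffMeasure_image_bounds (hstrict t) one_pos
    refine ⟨Metric.ball t δ, Metric.ball_mem_nhds t hδ, ?_⟩
    rw [hνA]
    refine ((h _ subset_rfl).2).trans_lt ?_
    rw [Real.volume_ball]
    exact ENNReal.mul_lt_top ENNReal.ofReal_lt_top ENNReal.ofReal_lt_top
  -- It suffices to compare intervals: `t ↦ ν (a, t]` turns out to have derivative `‖deriv γ t‖`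
  -- everywhere, and the fundamental theorem of calculus recovers its value at `b`.
  refine Measure.ext_of_Ioc _ _ fun a b hab => ?_
  have hint : ∀ c d, IntervalIntegrable (fun _ => (1 : ℝ)) ν c d := fun c d =>
    continuous_const.intervalIntegrable c d
  have hIoc : ∀ c d, c ≤ d → ∫ _ in c..d, (1 : ℝ) ∂ν = ν.real (Set.Ioc c d) := by
    intro c d hcd
    rw [intervalIntegral.integral_of_le hcd, setIntegral_const, smul_eq_mul, mul_one]
  have hderiv : ∀ t, HasDerivAt (fun s => ∫ _ in a..s, (1 : ℝ) ∂ν) ‖deriv γ t‖ t := by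
    intro t
    rw [hasDerivAt_iff_isLittleO, Asymptotics.isLittleO_iff]
    intro ε hε
    obtain ⟨δ, hδ, h⟩ := exists_hausdorffMeasure_image_bounds (hstrict t) hε
    have key : ∀ c d, c ≤ d → Set.Ioc c d ⊆ Metric.ball t δ →
        |ν.real (Set.Ioc c d) - (d - c) * ‖deriv γ t‖| ≤ ε * (d - c) := by
      intro c d hcd hsub
      obtain ⟨h1, h2⟩ := h _ hsub
      have hdc : 0 ≤ d - c := sub_nonneg.2 hcd
      rw [← hνA, Real.volume_Ioc, ← ENNReal.ofReal_mul' hdc] at h1 h2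
      have hne : ν (Set.Ioc c d) ≠ ⊤ := measure_Ioc_lt_top.ne
      have h1' := (ENNReal.ofReal_le_iff_le_toReal hne).1 h1
      have h2' := ENNReal.toReal_le_of_le_ofReal (by positivity) h2
      change _ ≤ ν.real _ at h1'
      change ν.real _ ≤ _ at h2'
      rw [abs_le]
      constructor <;> nlinarith
    filter_upwards [Metric.ball_mem_nhds t hδ] with s hs
    rw [intervalIntegral.integral_interval_sub_left (hint _ _) (hint _ _), smul_eq_mul]
    have hball := (convex_ball t δ).ordConnected
    rcases le_total t s with hts | hts
    · rw [hIoc _ _ hts, Real.norm_eq_abs, Real.norm_eq_abs, abs_of_nonneg (sub_nonneg.2 hts)]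
      exact key t s hts (Set.Ioc_subset_Icc_self.trans (hball.out (Metric.mem_ball_self hδ) hs))
    · rw [intervalIntegral.integral_symm, hIoc _ _ hts, Real.norm_eq_abs, Real.norm_eq_abs,
        abs_sub_comm s t, abs_of_nonneg (sub_nonneg.2 hts)]
      have := key s t hts (Set.Ioc_subset_Icc_self.trans (hball.out hs (Metric.mem_ball_self hδ)))
      rw [← abs_neg]
      convert this using 2
      ring
  have hF := intervalIntegral.integral_eq_sub_of_hasDerivAt (fun s _ => hderiv s)
    (hcont.intervalIntegrable a b)
  rw [intervalIntegral.integral_same, sub_zero, hIoc _ _ hab.le,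
    intervalIntegral.integral_of_le hab.le] at hF
  rw [withDensity_apply _ measurableSet_Ioc,
    ← ofReal_integral_eq_lintegral_ofReal (hcont.integrableOn_Ioc)
      (Eventually.of_forall fun s => norm_nonneg _), hF, measureReal_def,
    ENNReal.ofReal_toReal measure_Ioc_lt_top.ne]

theorem integral_range_hausdorffMeasure {γ : ℝ → E} (hγ : ContDiff ℝ 1 γ)
    (hemb : MeasurableEmbedding γ) (g : E → ℂ) :
    ∫ z in Set.range γ, g z ∂(μH[1] : Measure E) = ∫ s, ‖deriv γ s‖ • g (γ s) := by
  have hm : Measurable fun s => Real.toNNReal ‖deriv γ s‖ :=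
    (hγ.continuous_deriv le_rfl).norm.measurable.real_toNNReal
  rw [hausdorffMeasure_restrict_range_eq_map hγ hemb, hemb.integral_map]
  refine (integral_withDensity_eq_integral_smul hm _).trans ?_
  refine integral_congr_ae (Eventually.of_forall fun s => ?_)
  simp only [NNReal.smul_def, Real.coe_toNNReal _ (norm_nonneg _)]

theorem integrableOn_range_hausdorffMeasure {γ : ℝ → E} (hγ : ContDiff ℝ 1 γ)
    (hemb : MeasurableEmbedding γ) (g : E → ℂ) :
    IntegrableOn g (Set.range γ) (μH[1] : Measure E) ↔
      Integrable fun s => ‖deriv γ s‖ • g (γ s) := by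
  have hm : Measurable fun s => Real.toNNReal ‖deriv γ s‖ :=
    (hγ.continuous_deriv le_rfl).norm.measurable.real_toNNReal
  rw [IntegrableOn, hausdorffMeasure_restrict_range_eq_map hγ hemb, hemb.integrable_map_iff]
  refine (integrable_withDensity_iff_integrable_smul hm).trans ?_
  refine integrable_congr (Eventually.of_forall fun s => ?_)
  simp only [NNReal.smul_def, Real.coe_toNNReal _ (norm_nonneg _), Function.comp_apply]

end Curve

/-! Stokes' theorem for the region below a graph. -/

/-- A function on the plane in the coordinates `(s, v) ↦ s + i (v + φ s)`. -/
def shear (φ : ℝ → ℝ) (q : ℝ × ℝ) : ℂ := ⟨q.1, q.2 + φ q.1⟩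

theorem shear_eq (φ : ℝ → ℝ) (q : ℝ × ℝ) :
    shear φ q = (q.1 : ℂ) + ((q.2 + φ q.1 : ℝ) : ℂ) * Complex.I := by
  apply Complex.ext <;> simp [shear]

theorem contDiff_shear {φ : ℝ → ℝ} (hφ : ContDiff ℝ 1 φ) : ContDiff ℝ 1 (shear φ) := by
  have : shear φ = fun q => Complex.ofRealCLM q.1 +
      Complex.ofRealCLM (q.2 + φ q.1) * Complex.I := by
    funext q; rw [shear_eq]; rfl
  rw [this]
  fun_prop

/-- The shear along a continuous function, as a homeomorphism. -/
def shearHomeomorph (φ : ℝ → ℝ) (hφ : Continuous φ) : ℝ × ℝ ≃ₜ ℂ where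
  toFun := shear φ
  invFun z := (z.re, z.im - φ z.re)
  left_inv q := by simp [shear]
  right_inv z := by simp [shear]
  continuous_toFun := by
    have : shear φ = fun q => (q.1 : ℂ) + ((q.2 + φ q.1 : ℝ) : ℂ) * Complex.I :=
      funext (shear_eq φ)
    rw [this]
    fun_prop
  continuous_invFun := by fun_prop

theorem measurePreserving_shear {φ : ℝ → ℝ} (hφ : Continuous φ) :
    MeasurePreserving (shear φ) := by
  have h1 : MeasurePreserving (fun q : ℝ × ℝ => (q.1, q.2 + φ q.1)) := by
    refine (MeasurePreserving.id volume).skew_product (g := fun s u => u + φ s) (by fun_prop) ?_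
    exact Eventually.of_forall fun s => (measurePreserving_add_right volume (φ s)).map_eq
  exact (Complex.volume_preserving_equiv_real_prod.symm _).comp h1

theorem hasDerivAt_shear_left {φ : ℝ → ℝ} (hφ : ContDiff ℝ 1 φ) (s v : ℝ) :
    HasDerivAt (fun s => shear φ (s, v)) (1 + deriv φ s * Complex.I) s := by
  have h1 : HasDerivAt (fun s => v + φ s) (deriv φ s) s :=
    ((hφ.differentiable one_ne_zero s).hasDerivAt).const_add v
  have h2 := ((hasDerivAt_id s).ofReal_comp).add (h1.ofReal_comp.mul_const Complex.I)
  have h3 : (fun s => shear φ (s, v)) =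
      (fun s : ℝ => ((s : ℝ) : ℂ)) + fun s => ((v + φ s : ℝ) : ℂ) * Complex.I :=
    funext fun s => shear_eq φ _
  rw [h3]
  simpa only [id, Complex.ofReal_one] using h2

theorem hasDerivAt_shear_right (φ : ℝ → ℝ) (s v : ℝ) :
    HasDerivAt (fun v => shear φ (s, v)) Complex.I v := by
  have h1 : HasDerivAt (fun v => v + φ s) 1 v := (hasDerivAt_id v).add_const _
  have h2 := (h1.ofReal_comp.mul_const Complex.I).const_add (s : ℂ)
  rw [Complex.ofReal_one, one_mul] at h2
  exact h2.congr_of_eventuallyEq (Eventually.of_forall fun v => shear_eq φ _)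

theorem shear_snd_neg_iff {φ : ℝ → ℝ} (q : ℝ × ℝ) :
    (shear φ q).im < φ (shear φ q).re ↔ q.2 < 0 := by
  simp [shear]

/-- In the coordinates `(s, v)` of the shear the region is `v < 0`, and `2i ∂G/∂z* = i ∂_s G - (1 +
iφ'(s)) ∂_v G`. The first term integrates to zero along `s`, the second to a boundary value along
`v`. As the factor `1 + iφ'` does not depend on `v`, it is never differentiated and `C¹` suffices.
The minus sign appears because a region below a graph is on the left when `s` decreases. -/
theorem integral_dbar_below_graph {φ : ℝ → ℝ} (hφ : ContDiff ℝ 1 φ) {G : ℂ → ℂ}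
    (hG : ContDiff ℝ 1 G) (hGc : HasCompactSupport G) :
    2 * Complex.I * ∫ z in {z : ℂ | z.im < φ z.re}, dbar G z =
      -∫ s : ℝ, G (shear φ (s, 0)) * (1 + deriv φ s * Complex.I) := by
  set e := shearHomeomorph φ hφ.continuous
  have hmp : MeasurePreserving e := measurePreserving_shear hφ.continuous
  have hpre : e ⁻¹' {z : ℂ | z.im < φ z.re} = Set.univ ×ˢ Set.Iio 0 := by
    ext q; exact (shear_snd_neg_iff q).trans (by simp)
  rw [← hmp.setIntegral_preimage_emb e.measurableEmbedding, hpre]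
  have hdφ : Continuous (deriv φ) := hφ.continuous_deriv le_rfl
  have hdG : Continuous (fderiv ℝ G) := hG.continuous_fderiv one_ne_zero
  set A : ℝ × ℝ → ℂ := fun q => fderiv ℝ G (e q) (1 + deriv φ q.1 * Complex.I) with hA
  set B : ℝ × ℝ → ℂ := fun q => fderiv ℝ G (e q) Complex.I with hB
  set k : ℝ × ℝ → ℂ := fun q => 1 + deriv φ q.1 * Complex.I with hk
  have hec : Continuous e := e.continuous
  have hAc : Continuous A := by
    simp only [hA]; exact (hdG.comp hec).clm_apply (by fun_prop)
  have hBc : Continuous B := by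
    simp only [hB]; exact (hdG.comp hec).clm_apply continuous_const
  have hkc : Continuous k := by simp only [hk]; fun_prop
  have hsupp : HasCompactSupport fun q => fderiv ℝ G (e q) :=
    (hGc.fderiv ℝ).comp_homeomorph e
  have hAs : HasCompactSupport A := hsupp.mono' (by
    refine subset_trans ?_ subset_closure
    intro q hq hq0
    exact hq (by simp only [hA]; rw [show fderiv ℝ G (e q) = 0 from hq0]; rfl))
  have hBs : HasCompactSupport B := hsupp.mono' (by
    refine subset_trans ?_ subset_closure
    intro q hq hq0
    exact hq (by simp only [hB]; rw [show fderiv ℝ G (e q) = 0 from hq0]; rfl))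
  have hAi : Integrable A := hAc.integrable_of_hasCompactSupport hAs
  have hkB : HasCompactSupport fun q => k q * B q := hBs.mul_left
  have hkBi : Integrable fun q => k q * B q :=
    (hkc.mul hBc).integrable_of_hasCompactSupport hkB
  have hdb : ∀ q, 2 * Complex.I * dbar G (e q) = Complex.I * A q - k q * B q := by
    intro q
    have h1 : A q = fderiv ℝ G (e q) 1 + ((deriv φ q.1 : ℝ) : ℂ) * B q := by
      simp only [hA, hB, map_add]
      have : ((deriv φ q.1 : ℝ) : ℂ) * Complex.I = deriv φ q.1 • Complex.I := by
        rw [Complex.real_smul]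
      rw [this, map_smul, Complex.real_smul]
    rw [h1, dbar]
    simp only [hk]
    linear_combination (fderiv ℝ G (e q) Complex.I) * Complex.I_mul_I
  have hKs : ∀ s v, HasDerivAt (fun s => G (e (s, v))) (A (s, v)) s := fun s v =>
    ((hG.differentiable one_ne_zero _).hasFDerivAt).comp_hasDerivAt s
      (hasDerivAt_shear_left hφ s v)
  have hKv : ∀ s v, HasDerivAt (fun v => G (e (s, v))) (B (s, v)) v := fun s v =>
    ((hG.differentiable one_ne_zero _).hasFDerivAt).comp_hasDerivAt v
      (hasDerivAt_shear_right φ s v)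
  have hGe : HasCompactSupport fun q => G (e q) := hGc.comp_homeomorph e
  have hGec : Continuous fun q => G (e q) := hG.continuous.comp hec
  have hleft : ∀ {g : ℝ × ℝ → ℂ}, HasCompactSupport g → ∀ v,
      HasCompactSupport fun s => g (s, v) := fun hg v =>
    HasCompactSupport.intro (hg.isCompact.image continuous_fst) fun s hs =>
      image_eq_zero_of_notMem_tsupport fun h => hs ⟨_, h, rfl⟩
  have hright : ∀ {g : ℝ × ℝ → ℂ}, HasCompactSupport g → ∀ s,
      HasCompactSupport fun v => g (s, v) := fun hg s =>
    HasCompactSupport.intro (hg.isCompact.image continuous_snd) fun v hv =>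
      image_eq_zero_of_notMem_tsupport fun h => hv ⟨_, h, rfl⟩
  have hA0 : ∫ q in Set.univ ×ˢ Set.Iio 0, A q = 0 := by
    rw [Measure.volume_eq_prod, ← Measure.prod_restrict, integral_prod_symm]
    · refine integral_eq_zero_of_ae (Eventually.of_forall fun v => ?_)
      rw [Measure.restrict_univ]
      refine integral_eq_zero_of_hasDerivAt_of_integrable (fun s => hKs s v) ?_ ?_
      · exact (hAc.comp (by fun_prop)).integrable_of_hasCompactSupport (hleft hAs v)
      · exact (hGec.comp (by fun_prop)).integrable_of_hasCompactSupport (hleft hGe v)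
    · rw [Measure.prod_restrict]
      exact hAi.integrableOn
  have hB0 : ∫ q in Set.univ ×ˢ Set.Iio 0, k q * B q =
      ∫ s : ℝ, G (shear φ (s, 0)) * (1 + deriv φ s * Complex.I) := by
    rw [Measure.volume_eq_prod, setIntegral_prod _ hkBi.integrableOn, Measure.restrict_univ]
    refine integral_congr_ae (Eventually.of_forall fun s => ?_)
    have hd : deriv (fun v => G (e (s, v))) = fun v => B (s, v) := funext fun v => (hKv s v).deriv
    have hC : ContDiff ℝ 1 fun v => G (e (s, v)) :=
      hG.comp ((contDiff_shear hφ).comp (contDiff_const.prodMk contDiff_id))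
    have hI := HasCompactSupport.integral_Iic_deriv_eq hC (hright hGe s) 0
    rw [hd, integral_Iic_eq_integral_Iio] at hI
    simp only [hk]
    rw [integral_const_mul, hI, mul_comm]
    rfl
  rw [← integral_const_mul]
  simp_rw [hdb]
  rw [integral_sub (hAi.const_mul _).integrableOn hkBi.integrableOn, integral_const_mul, hA0, hB0,
    mul_zero, zero_sub]

/-! Boundary charts of a smooth domain. -/

theorem contDiff_mul_of_tsupport {E 𝔸 : Type*} [NormedAddCommGroup E] [NormedSpace ℝ E]
    [NormedRing 𝔸] [NormedAlgebra ℝ 𝔸] {n : WithTop ℕ∞} {χ g : E → 𝔸} (hχ : ContDiff ℝ n χ)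
    (hg : ∀ y ∈ tsupport χ, ContDiffAt ℝ n g y) : ContDiff ℝ n fun y => χ y * g y := by
  refine contDiff_iff_contDiffAt.2 fun y => ?_
  by_cases hy : y ∈ tsupport χ
  · exact hχ.contDiffAt.mul (hg y hy)
  · refine (contDiffAt_const (c := (0 : 𝔸))).congr_of_eventuallyEq ?_
    filter_upwards [notMem_tsupport_iff_eventuallyEq.1 hy] with z hz
    simp [hz]

/-- A bump function around `p` with support in a given neighbourhood. -/
theorem exists_contDiff_eventuallyEq_one {E : Type*} [NormedAddCommGroup E]
    [InnerProductSpace ℝ E] [FiniteDimensional ℝ E] {W : Set E} {p : E} (hW : W ∈ 𝓝 p) :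
    ∃ χ : E → ℝ, ContDiff ℝ 1 χ ∧ HasCompactSupport χ ∧ tsupport χ ⊆ W ∧ ∀ᶠ z in 𝓝 p, χ z = 1 := by
  obtain ⟨r, hr, hrW⟩ := Metric.nhds_basis_closedBall.mem_iff.1 hW
  let b : ContDiffBump p := ⟨r / 2, r, half_pos hr, half_lt_self hr⟩
  exact ⟨b, b.contDiff, b.hasCompactSupport, b.tsupport_eq.trans_subset hrW,
    b.eventuallyEq_one⟩

/-- Makes the local implicit function into a global one, since Stokes below a graph is stated for
`φ` on the whole line. -/
theorem exists_contDiff_eventuallyEq {ψ : ℝ → ℝ} {s₀ : ℝ} (hψ : ContDiffAt ℝ 1 ψ s₀) :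
    ∃ φ : ℝ → ℝ, ContDiff ℝ 1 φ ∧ φ =ᶠ[𝓝 s₀] ψ := by
  obtain ⟨χ, hχ, -, hsub, hone⟩ := exists_contDiff_eventuallyEq_one (hψ.eventually (by simp))
  refine ⟨fun s => χ s * ψ s, contDiff_mul_of_tsupport hχ fun y hy => hsub hy, ?_⟩
  filter_upwards [hone] with s hs
  rw [hs, one_mul]

/-- The graph of `φ` in the orthonormal frame `(a, i a)` with origin `p`. -/
def graphCurve (p a : ℂ) (φ : ℝ → ℝ) (s : ℝ) : ℂ := p + a * shear φ (s, 0)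

theorem hasDerivAt_graphCurve (p a : ℂ) {φ : ℝ → ℝ} (hφ : ContDiff ℝ 1 φ) (s : ℝ) :
    HasDerivAt (graphCurve p a φ) (a * (1 + deriv φ s * Complex.I)) s :=
  ((hasDerivAt_shear_left hφ s 0).const_mul a).const_add p

theorem contDiff_graphCurve (p a : ℂ) {φ : ℝ → ℝ} (hφ : ContDiff ℝ 1 φ) :
    ContDiff ℝ 1 (graphCurve p a φ) :=
  contDiff_const.add (contDiff_const.mul
    ((contDiff_shear hφ).comp (contDiff_id.prodMk contDiff_const)))

theorem measurableEmbedding_graphCurve (p : ℂ) {a : ℂ} (ha : a ≠ 0) {φ : ℝ → ℝ}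
    (hφ : ContDiff ℝ 1 φ) : MeasurableEmbedding (graphCurve p a φ) := by
  refine (contDiff_graphCurve p a hφ).continuous.measurableEmbedding fun s t hst => ?_
  have h := mul_left_cancel₀ ha (add_left_cancel hst)
  exact congrArg Complex.re h

/-- The region below the graph of `φ` in the orthonormal frame `(a, i a)` with origin `p`. -/
def belowGraph (p a : ℂ) (φ : ℝ → ℝ) : Set ℂ := {z | ((z - p) / a).im < φ ((z - p) / a).re}

/-- A shear followed by an affine map is a homeomorphism carrying the half-plane `v < 0` to the
region, and homeomorphisms preserve frontiers. -/
theorem frontier_belowGraph (p : ℂ) {a : ℂ} (ha : a ≠ 0) {φ : ℝ → ℝ} (hφ : Continuous φ) :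
    frontier (belowGraph p a φ) = Set.range (graphCurve p a φ) := by
  set T : ℝ × ℝ ≃ₜ ℂ := ((shearHomeomorph φ hφ).trans (Homeomorph.mulLeft₀ a ha)).trans
    (Homeomorph.addLeft p) with hT
  have hTq : ∀ q, T q = p + a * shear φ q := fun q => rfl
  have hpre : T ⁻¹' belowGraph p a φ = Set.univ ×ˢ Set.Iio 0 := by
    ext q
    have : (T q - p) / a = shear φ q := by rw [hTq]; field_simp; ring
    rw [Set.mem_preimage, belowGraph, Set.mem_ofPred_eq, this, shear_snd_neg_iff]
    simp
  have h1 := T.preimage_frontier (belowGraph p a φ)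
  rw [hpre, frontier_univ_prod_eq, frontier_Iio] at h1
  rw [← T.image_preimage (frontier _), h1]
  ext z
  constructor
  · rintro ⟨⟨s, v⟩, ⟨-, hv⟩, rfl⟩
    rw [Set.mem_singleton_iff] at hv
    subst hv
    exact ⟨s, rfl⟩
  · rintro ⟨s, rfl⟩
    exact ⟨(s, 0), ⟨trivial, rfl⟩, rfl⟩

/-- A plane vector orthogonal to `w = a(1 + iτ)` is a real multiple of `i w`; as `⟨i w, i a⟩ = 1`,
the multiple is `⟨g, i a⟩ > 0`. Used with `g` the gradient of a defining function and `w` the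
velocity of the graph. -/
theorem normalized_eq_of_inner {a g : ℂ} {τ : ℝ} (ha : ‖a‖ = 1)
    (h0 : inner ℝ g (a * (1 + τ * Complex.I)) = 0) (h1 : 0 < inner ℝ g (a * Complex.I)) :
    (‖g‖⁻¹ : ℝ) • g = (‖a * (1 + τ * Complex.I)‖⁻¹ : ℝ) •
      (Complex.I * (a * (1 + τ * Complex.I))) := by
  have hna : a.re * a.re + a.im * a.im = 1 := by
    rw [← Complex.normSq_apply, Complex.normSq_eq_norm_sq, ha, one_pow]
  set q := inner ℝ g (a * Complex.I) with hq
  have hqe : q = -(g.re * a.im) + g.im * a.re := by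
    rw [hq, Complex.inner]
    simp
    ring
  have h0' : g.re * (a.re - a.im * τ) + g.im * (a.re * τ + a.im) = 0 := by
    rw [← h0, Complex.inner]
    simp
    ring
  have hg : g = q • (Complex.I * (a * (1 + τ * Complex.I))) := by
    rw [hqe]
    apply Complex.ext
    · simp
      linear_combination (-g.re) * hna + a.re * h0'
    · simp
      linear_combination (-g.im) * hna + a.im * h0'
  have hv : 0 < ‖a * (1 + τ * Complex.I)‖ := by
    rw [norm_pos_iff]
    refine mul_ne_zero (fun h => by simp [h] at ha) fun h => ?_
    simpa using congrArg Complex.re h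
  rw [hg, norm_smul, norm_mul Complex.I, Complex.norm_I, one_mul, Real.norm_eq_abs,
    abs_of_pos h1, smul_smul]
  congr 1
  field_simp

theorem inner_gradient_eq_fderiv (ρ : ℂ → ℝ) (z v : ℂ) :
    inner ℝ (gradient ρ z) v = fderiv ℝ ρ z v := by
  rw [gradient, InnerProductSpace.toDual_symm_apply]

/-- The implicit function theorem for a zero set transversal to the direction `i a`. -/
theorem exists_graphCurve_subset_zero {p a : ℂ} {ρ : ℂ → ℝ} (hρ : ContDiffAt ℝ 1 ρ p)
    (h0 : ρ p = 0) (hpos : fderiv ℝ ρ p (a * Complex.I) ≠ 0) :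
    ∃ φ : ℝ → ℝ, ContDiff ℝ 1 φ ∧ φ 0 = 0 ∧ ∀ᶠ s in 𝓝 0, ρ (graphCurve p a φ s) = 0 := by
  set c : ℝ × ℝ → ℂ := fun q => p + a * (q.1 + q.2 * Complex.I) with hc
  have hc1 : ContDiff ℝ 1 c := by
    have : c = fun q => p + a * (Complex.ofRealCLM q.1 + Complex.ofRealCLM q.2 * Complex.I) := rfl
    rw [this]
    fun_prop
  have hc0 : c (0, 0) = p := by simp [hc]
  have hf : ContDiffAt ℝ 1 (ρ ∘ c) (0, 0) :=
    ContDiffAt.comp _ (by rwa [hc0]) hc1.contDiffAt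
  have hfd : (fderiv ℝ (ρ ∘ c) (0, 0) ∘L .inr ℝ ℝ ℝ) 1 = fderiv ℝ ρ p (a * Complex.I) := by
    have h1 : HasDerivAt (fun u : ℝ => c (0, u)) (a * Complex.I) 0 := by
      have := (((hasDerivAt_id (0 : ℝ)).ofReal_comp.mul_const Complex.I).const_mul a).const_add p
      simpa [hc] using this
    have h2 : HasDerivAt (fun u : ℝ => (ρ ∘ c) (0, u)) (fderiv ℝ ρ p (a * Complex.I)) 0 := by
      have h3 : HasFDerivAt ρ (fderiv ℝ ρ p) (c (0, 0)) := by
        rw [hc0]; exact (hρ.differentiableAt one_ne_zero).hasFDerivAt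
      exact h3.comp_hasDerivAt 0 h1
    have h4 : HasDerivAt (fun u : ℝ => (ρ ∘ c) (0, u))
        (fderiv ℝ (ρ ∘ c) (0, 0) ((0 : ℝ), (1 : ℝ))) 0 :=
      (hf.differentiableAt one_ne_zero).hasFDerivAt.comp_hasDerivAt 0
        ((hasDerivAt_const (0 : ℝ) (0 : ℝ)).prodMk (hasDerivAt_id (0 : ℝ)))
    exact h4.unique h2
  have hinv : (fderiv ℝ (ρ ∘ c) (0, 0) ∘L .inr ℝ ℝ ℝ).IsInvertible := by
    refine ⟨ContinuousLinearEquiv.unitsEquivAut ℝ (Units.mk0 _ hpos), ?_⟩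
    ext
    rw [hfd]
    simp
  obtain ⟨φ, hφ, hφψ⟩ := exists_contDiff_eventuallyEq
    (hf.contDiffAt_implicitFunction one_ne_zero hinv)
  refine ⟨φ, hφ, ?_, ?_⟩
  · rw [hφψ.self_of_nhds]
    exact hf.implicitFunction_apply_self one_ne_zero hinv
  · filter_upwards [hφψ, hf.eventually_apply_implicitFunction one_ne_zero hinv] with s h1 h2
    rw [← h1, Function.comp_apply, Function.comp_apply, hc0, h0] at h2
    rw [graphCurve, shear_eq, zero_add]
    exact h2

/-- Near a boundary point, a smooth domain is the region below the graph of a `C¹` function. -/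
theorem IsLocalDefiningFunction.exists_graph {D : Set ℂ} {p : ℂ} {ρ : ℂ → ℝ}
    (h : IsLocalDefiningFunction D p ρ) :
    ∃ (a : ℂ) (φ : ℝ → ℝ), ‖a‖ = 1 ∧ ContDiff ℝ 1 φ ∧ ∃ W : Set ℂ, IsOpen W ∧ p ∈ W ∧
      (∀ z ∈ W, z ∈ D ↔ z ∈ belowGraph p a φ) ∧
      ∀ s, graphCurve p a φ s ∈ W →
        ‖deriv (graphCurve p a φ) s‖ • unitTangent D (graphCurve p a φ s) =
          -deriv (graphCurve p a φ) s := by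
  obtain ⟨h0, hg, V, hV, hpV, hs, hD⟩ := h
  set N := gradient ρ p with hN
  have hNn : 0 < ‖N‖ := norm_pos_iff.2 hg
  -- Chosen so that `i a` is the unit gradient: `ρ` increases upwards in the frame `(a, i a)`, and
  -- `D` lies below the graph.
  set a : ℂ := -Complex.I * (‖N‖⁻¹ • N) with ha
  have haI : a * Complex.I = ‖N‖⁻¹ • N := by
    rw [ha]; linear_combination (-(‖N‖⁻¹ • N)) * Complex.I_mul_I
  have ha1 : ‖a‖ = 1 := by
    rw [ha, norm_mul, norm_neg, Complex.norm_I, one_mul, norm_smul, norm_inv, norm_norm,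
      inv_mul_cancel₀ hNn.ne']
  have ha0 : a ≠ 0 := fun h => by simp [h] at ha1
  have hC1 : ∀ z ∈ V, ContDiffAt ℝ 1 ρ z := fun z hz =>
    (hs.contDiffAt (hV.mem_nhds hz)).of_le (by simp)
  have hposp : 0 < fderiv ℝ ρ p (a * Complex.I) := by
    rw [← inner_gradient_eq_fderiv, haI, inner_smul_right, real_inner_self_eq_norm_sq]
    positivity
  have hcont : ContinuousAt (fun z => fderiv ℝ ρ z (a * Complex.I)) p :=
    (((hC1 p hpV).fderiv_right (m := 0) (by simp)).continuousAt).clm_apply continuousAt_const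
  obtain ⟨φ, hφ, hφ0, hzero⟩ := exists_graphCurve_subset_zero (hC1 p hpV) h0 hposp.ne'
  obtain ⟨r₀, hr₀, hball₀⟩ := Metric.eventually_nhds_iff_ball.1
    ((hV.eventually_mem hpV).and (hcont.eventually_const_lt hposp))
  have hγ0 : graphCurve p a φ 0 = p := by simp [graphCurve, shear_eq, hφ0]
  have hγc := (contDiff_graphCurve p a hφ).continuous
  have hγb : ∀ᶠ s in 𝓝 (0 : ℝ), graphCurve p a φ s ∈ Metric.ball p r₀ :=
    hγc.continuousAt.eventually_mem (by rw [hγ0]; exact Metric.ball_mem_nhds p hr₀)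
  -- In the ball of radius `r₀`, `ρ` increases in the direction `i a`; over abscissas smaller than
  -- `r₁` the graph stays in that ball and in the zero set of `ρ`.
  obtain ⟨r₁, hr₁, hball₁⟩ := Metric.eventually_nhds_iff_ball.1 (hzero.and hγb)
  have hcoord : ∀ z ∈ Metric.ball p r₁, ((z - p) / a).re ∈ Metric.ball (0 : ℝ) r₁ := by
    intro z hz
    rw [mem_ball_zero_iff]
    refine (Complex.abs_re_le_norm _).trans_lt ?_
    rwa [norm_div, ha1, div_one, ← mem_ball_iff_norm]
  have hWr : ∀ {z}, z ∈ Metric.ball p (min r₀ r₁) → z ∈ Metric.ball p r₀ ∧ z ∈ Metric.ball p r₁ :=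
    fun hz => ⟨Metric.ball_subset_ball (min_le_left _ _) hz,
      Metric.ball_subset_ball (min_le_right _ _) hz⟩
  refine ⟨a, φ, ha1, hφ, Metric.ball p (min r₀ r₁), Metric.isOpen_ball,
    Metric.mem_ball_self (lt_min hr₀ hr₁), fun z hz => ?_, fun s hsW => ?_⟩
  · obtain ⟨hz0, hz1⟩ := hWr hz
    set w := (z - p) / a with hw
    have hzw : z = p + a * ((w.re : ℂ) + w.im * Complex.I) := by
      rw [Complex.re_add_im, hw]; field_simp; ring
    obtain ⟨hρ0, hb0⟩ := hball₁ _ (hcoord z hz1)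
    rw [← hw] at hρ0 hb0
    -- The line through `z` in the direction `i a` meets the ball in an interval, on which `ρ` is
    -- strictly increasing with its zero at height `φ w.re`. Hence the sign of `ρ z` tells on which
    -- side of the graph `z` lies.
    let ℓ : ℝ →ᵃ[ℝ] ℂ := AffineMap.lineMap (p + a * w.re) (p + a * w.re + a * Complex.I)
    have hℓ : ∀ u : ℝ, ℓ u = p + a * ((w.re : ℂ) + u * Complex.I) := by
      intro u
      simp only [ℓ, AffineMap.lineMap_apply, vsub_eq_sub, vadd_eq_add, add_sub_cancel_left,
        Complex.real_smul]
      ring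
    have hℓd : ∀ u, HasDerivAt ℓ (a * Complex.I) u := by
      intro u
      have := AffineMap.hasDerivAt_lineMap (a := p + a * w.re) (b := p + a * w.re + a * Complex.I)
        (x := u)
      rwa [add_sub_cancel_left] at this
    have hconv : Convex ℝ (ℓ ⁻¹' Metric.ball p r₀) := (convex_ball p r₀).affine_preimage ℓ
    have hder : ∀ u ∈ ℓ ⁻¹' Metric.ball p r₀,
        HasDerivAt (fun u => ρ (ℓ u)) (fderiv ℝ ρ (ℓ u) (a * Complex.I)) u := fun u hu =>
      ((hC1 _ (hball₀ _ hu).1).differentiableAt one_ne_zero).hasFDerivAt.comp_hasDerivAt u (hℓd u)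
    have hmono : StrictMonoOn (fun u => ρ (ℓ u)) (ℓ ⁻¹' Metric.ball p r₀) := by
      refine strictMonoOn_of_deriv_pos hconv
        (fun u hu => (hder u hu).continuousAt.continuousWithinAt) fun u hu => ?_
      have hu' := interior_subset hu
      rw [(hder u hu').deriv]
      exact (hball₀ _ hu').2
    have hφℓ : graphCurve p a φ w.re = ℓ (φ w.re) := by
      rw [hℓ, graphCurve, shear_eq, zero_add]
    have hz' : z = ℓ w.im := by rw [hℓ]; exact hzw
    have hiff := hmono.lt_iff_lt (a := w.im) (b := φ w.re)
      (by rw [Set.mem_preimage, ← hz']; exact hz0) (by rw [Set.mem_preimage, ← hφℓ]; exact hb0)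
    rw [← hz', ← hφℓ, hρ0] at hiff
    rw [hD z (hball₀ z hz0).1, hiff]
    rfl
  · obtain ⟨hz0, hz1⟩ := hWr hsW
    have hs1 := hcoord _ hz1
    have hres : ((graphCurve p a φ s - p) / a).re = s := by
      rw [graphCurve, add_sub_cancel_left, mul_div_cancel_left₀ _ ha0]; rfl
    rw [hres] at hs1
    have hd := hasDerivAt_graphCurve p a hφ s
    obtain ⟨hzV, hzpos⟩ := hball₀ _ hz0
    have hfz : HasFDerivAt ρ (fderiv ℝ ρ (graphCurve p a φ s)) (graphCurve p a φ s) :=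
      ((hC1 _ hzV).differentiableAt one_ne_zero).hasFDerivAt
    have hd0 : HasDerivAt (fun s => ρ (graphCurve p a φ s)) 0 s :=
      (hasDerivAt_const s (0 : ℝ)).congr_of_eventuallyEq <| by
        filter_upwards [Metric.isOpen_ball.mem_nhds hs1] with s' hs'
        exact (hball₁ s' hs').1
    have horth := (hfz.comp_hasDerivAt s hd).unique hd0
    rw [← inner_gradient_eq_fderiv] at horth hzpos
    -- The same `ρ` serves at every nearby boundary point, so the normal there, defined through an
    -- arbitrary choice, can be computed from `ρ`.
    have hloc : IsLocalDefiningFunction D (graphCurve p a φ s) ρ :=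
      ⟨(hball₁ s hs1).1, fun h => by simp [h] at hzpos, V, hV, hzV, hs, hD⟩
    rw [unitTangent, outerNormal_eq hloc, normalized_eq_of_inner ha1 horth hzpos, hd.deriv]
    set v := a * (1 + ((deriv φ s : ℝ) : ℂ) * Complex.I) with hv
    have hv0 : ‖v‖ ≠ 0 := by
      rw [norm_ne_zero_iff]
      refine mul_ne_zero ha0 fun h => ?_
      simpa using congrArg Complex.re h
    rw [mul_smul_comm, smul_smul, mul_inv_cancel₀ hv0, one_smul]
    linear_combination v * Complex.I_mul_I

/-! Stokes' theorem for smooth domains. -/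

/-- Stokes' theorem `∫_{∂D} G dz = 2i ∫_D ∂G/∂z* dℓ` holds for `D` and `G`. -/
def HasStokes (D : Set ℂ) (G : ℂ → ℂ) : Prop :=
  IntegrableOn (fun z => G z * unitTangent D z) (frontier D) (μH[1] : Measure ℂ) ∧
    contourIntegral D G = 2 * Complex.I * ∫ z in D, dbar G z

theorem continuous_dbar {G : ℂ → ℂ} (hG : ContDiff ℝ 1 G) : Continuous (dbar G) := by
  have h := hG.continuous_fderiv one_ne_zero
  unfold dbar
  fun_prop

theorem dbar_eq_zero_of_notMem_tsupport {G : ℂ → ℂ} {z : ℂ} (hz : z ∉ tsupport G) :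
    dbar G z = 0 := by
  have : fderiv ℝ G z = 0 := by
    by_contra h
    exact hz (support_fderiv_subset ℝ h)
  simp [dbar, this]

theorem integrable_dbar {G : ℂ → ℂ} (hG : ContDiff ℝ 1 G) (hGc : HasCompactSupport G) :
    Integrable (dbar G) :=
  (continuous_dbar hG).integrable_of_hasCompactSupport
    (HasCompactSupport.intro hGc.isCompact fun _ => dbar_eq_zero_of_notMem_tsupport)

theorem dbar_add {F G : ℂ → ℂ} (hF : Differentiable ℝ F) (hG : Differentiable ℝ G) (z : ℂ) :
    dbar (fun z => F z + G z) z = dbar F z + dbar G z := by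
  rw [dbar, fderiv_fun_add (hF z) (hG z), dbar, dbar]
  simp only [add_apply]
  ring

theorem HasStokes.add {D : Set ℂ} {F G : ℂ → ℂ} (hF : ContDiff ℝ 1 F) (hFc : HasCompactSupport F)
    (hG : ContDiff ℝ 1 G) (hGc : HasCompactSupport G) (h₁ : HasStokes D F) (h₂ : HasStokes D G) :
    HasStokes D fun z => F z + G z := by
  have hfun : (fun z => (F z + G z) * unitTangent D z) =
      fun z => F z * unitTangent D z + G z * unitTangent D z := funext fun z => add_mul _ _ _
  refine ⟨?_, ?_⟩
  · rw [hfun]; exact h₁.1.add h₂.1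
  · have e1 := h₁.2
    have e2 := h₂.2
    unfold contourIntegral at e1 e2 ⊢
    rw [hfun, integral_add h₁.1 h₂.1, e1, e2, ← mul_add,
      ← integral_add (integrable_dbar hF hFc).integrableOn (integrable_dbar hG hGc).integrableOn]
    simp only [dbar_add (hF.differentiable one_ne_zero) (hG.differentiable one_ne_zero)]

theorem hasStokes_of_eq_zero_on_frontier {D : Set ℂ} {G : ℂ → ℂ} (h0 : ∀ z ∈ frontier D, G z = 0)
    (hint : ∫ z in D, dbar G z = 0) : HasStokes D G := by
  have h1 : ∀ z ∈ frontier D, G z * unitTangent D z = 0 := fun z hz => by rw [h0 z hz, zero_mul]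
  refine ⟨?_, ?_⟩
  · exact (integrableOn_zero (ε' := ℂ)).congr_fun (fun z hz => (h1 z hz).symm)
      isClosed_frontier.measurableSet
  · rw [hint, mul_zero]
    exact setIntegral_eq_zero_of_forall_eq_zero h1

/-- Stokes below a horizontal line that passes above the support, so that the boundary term
vanishes. -/
theorem integral_dbar_eq_zero {G : ℂ → ℂ} (hG : ContDiff ℝ 1 G) (hGc : HasCompactSupport G) :
    ∫ z, dbar G z = 0 := by
  obtain ⟨C, hC⟩ := hGc.isCompact.isBounded.exists_norm_le
  have hout : ∀ z : ℂ, ¬ z.im < C + 1 → z ∉ tsupport G := fun z hz hzG => by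
    have := (Complex.im_le_norm z).trans (hC z hzG)
    linarith
  have h := integral_dbar_below_graph (φ := fun _ => C + 1) contDiff_const hG hGc
  have hr : ∫ s : ℝ, G (shear (fun _ => C + 1) (s, 0)) *
      (1 + ((deriv (fun _ : ℝ => C + 1) s : ℝ) : ℂ) * Complex.I) = 0 := by
    refine integral_eq_zero_of_ae (Eventually.of_forall fun s => ?_)
    simp only [image_eq_zero_of_notMem_tsupport (hout (shear (fun _ => C + 1) (s, 0))
      (by simp [shear])), zero_mul, Pi.zero_apply]
  rw [hr, neg_zero] at h
  rw [← setIntegral_eq_integral_of_forall_compl_eq_zero (s := {z : ℂ | z.im < C + 1})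
    fun z hz => dbar_eq_zero_of_notMem_tsupport (hout z hz)]
  simpa using h

theorem hasStokes_of_tsupport_subset_interior {D : Set ℂ} (hD : IsOpen D) {G : ℂ → ℂ}
    (hG : ContDiff ℝ 1 G) (hGc : HasCompactSupport G) (hsub : tsupport G ⊆ D) : HasStokes D G := by
  refine hasStokes_of_eq_zero_on_frontier (fun z hz => ?_) ?_
  · rw [hD.frontier_eq] at hz
    exact image_eq_zero_of_notMem_tsupport fun h => hz.2 (hsub h)
  · rw [setIntegral_eq_integral_of_forall_compl_eq_zero, integral_dbar_eq_zero hG hGc]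
    exact fun z hz => dbar_eq_zero_of_notMem_tsupport fun h => hz (hsub h)

theorem hasStokes_of_tsupport_subset_exterior {D : Set ℂ} {G : ℂ → ℂ}
    (hsub : tsupport G ⊆ (closure D)ᶜ) : HasStokes D G := by
  refine hasStokes_of_eq_zero_on_frontier (fun z hz => ?_) ?_
  · exact image_eq_zero_of_notMem_tsupport fun h => hsub h (frontier_subset_closure hz)
  · exact setIntegral_eq_zero_of_forall_eq_zero fun z hz =>
      dbar_eq_zero_of_notMem_tsupport fun h => hsub h (subset_closure hz)

theorem indicator_eq_of_inter_eq {S T W : Set ℂ} {g : ℂ → ℂ} (h : S ∩ W = T ∩ W)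
    (hg : ∀ z ∉ W, g z = 0) : S.indicator g = T.indicator g := by
  funext z
  by_cases hz : z ∈ W
  · have : z ∈ S ↔ z ∈ T := by simpa [hz] using Set.ext_iff.1 h z
    by_cases hS : z ∈ S
    · rw [Set.indicator_of_mem hS, Set.indicator_of_mem (this.1 hS)]
    · rw [Set.indicator_of_notMem hS, Set.indicator_of_notMem fun hT => hS (this.2 hT)]
  · rw [Set.indicator_apply_eq_zero.2 fun _ => hg z hz,
      Set.indicator_apply_eq_zero.2 fun _ => hg z hz]

/-- By the chain rule `∂/∂w*` of `G(p + a w)` brings out the conjugate of `a`, and `a` times its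
conjugate is `1`. -/
theorem dbar_comp_affine {G : ℂ → ℂ} (hG : Differentiable ℝ G) (p : ℂ) {a : ℂ} (ha : ‖a‖ = 1)
    (w : ℂ) : a * dbar (fun w => G (p + a * w)) w = dbar G (p + a * w) := by
  have hd : HasFDerivAt (fun w => p + a * w) (ContinuousLinearMap.mul ℝ ℂ a) w :=
    ((ContinuousLinearMap.mul ℝ ℂ a).hasFDerivAt).const_add p
  have hc := ((hG (p + a * w)).hasFDerivAt.comp w hd).fderiv
  have hl : ∀ v : ℂ, fderiv ℝ G (p + a * w) v = v.re * fderiv ℝ G (p + a * w) 1 +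
      v.im * fderiv ℝ G (p + a * w) Complex.I := by
    intro v
    have : v = v.re • (1 : ℂ) + v.im • Complex.I := by
      simp [Complex.re_add_im]
    conv_lhs => rw [this]
    rw [map_add, map_smul, map_smul, Complex.real_smul, Complex.real_smul]
  have hc' : fderiv ℝ (fun w => G (p + a * w)) w =
      (fderiv ℝ G (p + a * w)).comp (ContinuousLinearMap.mul ℝ ℂ a) := hc
  have hna : a.re * a.re + a.im * a.im = 1 := by
    rw [← Complex.normSq_apply, Complex.normSq_eq_norm_sq, ha, one_pow]
  have hnaC : (a.re : ℂ) * a.re + a.im * a.im = 1 := by exact_mod_cast hna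
  rw [dbar, dbar, hc']
  simp only [ContinuousLinearMap.comp_apply, ContinuousLinearMap.mul_apply', mul_one]
  rw [hl a, hl (a * Complex.I)]
  simp only [Complex.mul_re, Complex.mul_im, Complex.I_re, Complex.I_im, mul_zero, mul_one,
    zero_sub, add_zero, Complex.ofReal_neg]
  generalize fderiv ℝ G (p + a * w) 1 = A
  generalize fderiv ℝ G (p + a * w) Complex.I = B
  conv_lhs => rw [← Complex.re_add_im a]
  simp only [Complex.add_re, Complex.add_im, Complex.ofReal_re, Complex.ofReal_im, Complex.mul_re,
    Complex.mul_im, Complex.I_re, Complex.I_im, mul_zero, mul_one, sub_zero, add_zero, zero_add]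
  linear_combination (A + Complex.I * B) / 2 * hnaC +
    (a.re * a.im * B / 2 - a.im * a.im * A / 2) * Complex.I_mul_I

/-- A rigid motion preserves area, and the factor `a` from `dbar_comp_affine` is the one by which it
multiplies the velocity of the curve. -/
theorem integral_dbar_belowGraph {p a : ℂ} (ha : ‖a‖ = 1) {φ : ℝ → ℝ} (hφ : ContDiff ℝ 1 φ)
    {G : ℂ → ℂ} (hG : ContDiff ℝ 1 G) (hGc : HasCompactSupport G) :
    2 * Complex.I * ∫ z in belowGraph p a φ, dbar G z =
      -∫ s : ℝ, G (graphCurve p a φ s) * deriv (graphCurve p a φ) s := by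
  have ha0 : a ≠ 0 := fun h => by simp [h] at ha
  set T : ℂ ≃ₜ ℂ := (Homeomorph.mulLeft₀ a ha0).trans (Homeomorph.addLeft p) with hT
  have hTw : ∀ w, T w = p + a * w := fun w => rfl
  have hmp : MeasurePreserving T := by
    have h1 : MeasurePreserving (fun w : ℂ => a * w) :=
      (rotation (⟨a, mem_sphere_zero_iff_norm.2 ha⟩ : Circle)).measurePreserving
    exact (measurePreserving_add_left volume p).comp h1
  have hpre : T ⁻¹' belowGraph p a φ = {w : ℂ | w.im < φ w.re} := by
    ext w
    have : (T w - p) / a = w := by rw [hTw]; field_simp; ring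
    rw [Set.mem_preimage, belowGraph, Set.mem_ofPred_eq, this, Set.mem_ofPred_eq]
  have hG' : ContDiff ℝ 1 fun w => G (p + a * w) :=
    hG.comp (contDiff_const.add (contDiff_const.mul contDiff_id))
  have h := integral_dbar_below_graph hφ hG' (hGc.comp_homeomorph T)
  rw [← hmp.setIntegral_preimage_emb T.measurableEmbedding, hpre]
  simp only [hTw, ← dbar_comp_affine (hG.differentiable one_ne_zero) p ha,
    (hasDerivAt_graphCurve p a hφ _).deriv]
  rw [integral_const_mul, mul_left_comm, h, mul_neg, ← integral_const_mul]
  congr 1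
  refine integral_congr_ae (Eventually.of_forall fun s => ?_)
  simp only [graphCurve]
  ring

/-- Since `G` vanishes off the chart `W`, both `D` and its frontier may be replaced by the region
below the graph and the graph itself; the arc length formula then turns `τ ds` into `-γ'(s) ds`. -/
theorem IsLocalDefiningFunction.exists_hasStokes {D : Set ℂ} {p : ℂ} {ρ : ℂ → ℝ}
    (hD : IsOpen D) (h : IsLocalDefiningFunction D p ρ) :
    ∃ W ∈ 𝓝 p, ∀ G : ℂ → ℂ, ContDiff ℝ 1 G → HasCompactSupport G → tsupport G ⊆ W →
      HasStokes D G := by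
  obtain ⟨a, φ, ha, hφ, W, hW, hpW, hDW, htan⟩ := h.exists_graph
  refine ⟨W, hW.mem_nhds hpW, fun G hG hGc hsub => ?_⟩
  have ha0 : a ≠ 0 := fun h => by simp [h] at ha
  set γ := graphCurve p a φ with hγ
  have hγ1 : ContDiff ℝ 1 γ := contDiff_graphCurve p a hφ
  have hemb : MeasurableEmbedding γ := measurableEmbedding_graphCurve p ha0 hφ
  have hG0 : ∀ z ∉ W, G z = 0 := fun z hz => image_eq_zero_of_notMem_tsupport fun h => hz (hsub h)
  have hint : D ∩ W = belowGraph p a φ ∩ W := by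
    ext z; exact and_congr_left fun hz => hDW z hz
  have hfr : frontier D ∩ W = Set.range γ ∩ W := by
    rw [← frontier_inter_open_inter hW, hint, frontier_inter_open_inter hW,
      frontier_belowGraph p ha0 hφ.continuous]
  have hind : (frontier D).indicator (fun z => G z * unitTangent D z) =
      (Set.range γ).indicator fun z => G z * unitTangent D z :=
    indicator_eq_of_inter_eq hfr fun z hz => by rw [hG0 z hz, zero_mul]
  have hms : MeasurableSet (Set.range γ) := hemb.measurableSet_range
  have hmf : MeasurableSet (frontier D) := isClosed_frontier.measurableSet
  have hpt : (fun s => ‖deriv γ s‖ • (G (γ s) * unitTangent D (γ s))) =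
      fun s => -(G (γ s) * deriv γ s) := by
    funext s
    by_cases hs : γ s ∈ W
    · rw [← mul_smul_comm, htan s hs, mul_neg]
    · rw [hG0 _ hs, zero_mul, zero_mul, smul_zero, neg_zero]
  -- The parameter is the abscissa in the frame, so `|s| ≤ ‖γ s - p‖` and bounded sets have bounded
  -- preimages.
  have hGγ : HasCompactSupport fun s => G (γ s) := by
    obtain ⟨C, hC⟩ := hGc.isCompact.isBounded.exists_norm_le
    refine HasCompactSupport.intro (isCompact_closedBall (0 : ℝ) (C + ‖p‖)) fun s hs => ?_
    refine image_eq_zero_of_notMem_tsupport fun h => hs ?_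
    have h1 : (s : ℝ) = ((γ s - p) / a).re := by
      rw [hγ, graphCurve, add_sub_cancel_left, mul_div_cancel_left₀ _ ha0]; rfl
    rw [mem_closedBall_zero_iff, h1]
    refine (Complex.abs_re_le_norm _).trans ?_
    rw [norm_div, ha, div_one]
    exact (norm_sub_le _ _).trans (by gcongr; exact hC _ h)
  refine ⟨?_, ?_⟩
  · rw [← integrable_indicator_iff hmf, hind, integrable_indicator_iff hms,
      integrableOn_range_hausdorffMeasure hγ1 hemb, hpt]
    exact (((hG.continuous.comp hγ1.continuous).mul
      (hγ1.continuous_deriv le_rfl)).integrable_of_hasCompactSupport hGγ.mul_right).neg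
  · have hmD : MeasurableSet D := hD.measurableSet
    have hmE : MeasurableSet (belowGraph p a φ) := by
      have hφm := hφ.continuous
      refine (isOpen_lt ?_ ?_).measurableSet
      · fun_prop
      · fun_prop
    rw [contourIntegral, ← integral_indicator hmf, hind, integral_indicator hms,
      integral_range_hausdorffMeasure hγ1 hemb, hpt, integral_neg,
      ← integral_dbar_belowGraph ha hφ hG hGc, ← integral_indicator hmD,
      ← integral_indicator hmE, indicator_eq_of_inter_eq hint fun z hz =>
        dbar_eq_zero_of_notMem_tsupport fun h => hz (hsub h)]

/-- Stokes' theorem for a smooth plane domain. -/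
theorem IsSmoothDomain.hasStokes {D : Set ℂ} (hD : IsSmoothDomain D) {G : ℂ → ℂ}
    (hG : ContDiff ℝ 1 G) (hGc : HasCompactSupport G) : HasStokes D G := by
  have hloc : ∀ p : ℂ, ∃ W ∈ 𝓝 p, ∀ G : ℂ → ℂ, ContDiff ℝ 1 G → HasCompactSupport G →
      tsupport G ⊆ W → HasStokes D G := by
    intro p
    by_cases hp : p ∈ D
    · exact ⟨D, hD.isOpen.mem_nhds hp, fun G h1 h2 h3 =>
        hasStokes_of_tsupport_subset_interior hD.isOpen h1 h2 h3⟩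
    by_cases hp' : p ∈ closure D
    · obtain ⟨ρ, hρ⟩ := hD.smooth_boundary p (by rw [hD.isOpen.frontier_eq]; exact ⟨hp', hp⟩)
      exact hρ.exists_hasStokes hD.isOpen
    · exact ⟨_, isClosed_closure.isOpen_compl.mem_nhds hp', fun G _ _ h3 =>
        hasStokes_of_tsupport_subset_exterior h3⟩
  -- Induction on compact sets replaces a partition of unity. The cutoff has to work for every `F`,
  -- because the union step applies the second cutoff to `(1 - χ₁) F`.
  have hcut : ∃ χ : ℂ → ℝ, ContDiff ℝ 1 χ ∧ (∀ z ∈ tsupport G, χ z = 1) ∧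
      ∀ F : ℂ → ℂ, ContDiff ℝ 1 F → HasCompactSupport F → HasStokes D fun z => (χ z : ℂ) * F z := by
    refine hGc.isCompact.induction_on (p := fun K => ∃ χ : ℂ → ℝ, ContDiff ℝ 1 χ ∧
      (∀ z ∈ K, χ z = 1) ∧ ∀ F : ℂ → ℂ, ContDiff ℝ 1 F → HasCompactSupport F →
        HasStokes D fun z => (χ z : ℂ) * F z) ?_ ?_ ?_ ?_
    · refine ⟨fun _ => 0, contDiff_const, by simp, fun F _ _ => ?_⟩
      exact hasStokes_of_eq_zero_on_frontier (by simp) (by simp [dbar])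
    · rintro S T hST ⟨χ, h1, h2, h3⟩
      exact ⟨χ, h1, fun z hz => h2 z (hST hz), h3⟩
    · rintro S T ⟨χ₁, h1, h2, h3⟩ ⟨χ₂, k1, k2, k3⟩
      -- Equal to `1` wherever `χ₁` or `χ₂` is.
      refine ⟨fun z => χ₁ z + χ₂ z * (1 - χ₁ z), by fun_prop, ?_, fun F hF hFc => ?_⟩
      · rintro z (hz | hz)
        · simp [h2 z hz]
        · simp [k2 z hz]
      · have c1 : ContDiff ℝ 1 fun z => ((χ₁ z : ℝ) : ℂ) := Complex.ofRealCLM.contDiff.comp h1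
        have c2 : ContDiff ℝ 1 fun z => ((χ₂ z : ℝ) : ℂ) := Complex.ofRealCLM.contDiff.comp k1
        have hF' : ContDiff ℝ 1 fun z => (1 - (χ₁ z : ℂ)) * F z := (contDiff_const.sub c1).mul hF
        have hFc' : HasCompactSupport fun z => (1 - (χ₁ z : ℂ)) * F z := hFc.mul_left
        have := (h3 F hF hFc).add (c1.mul hF) hFc.mul_left (c2.mul hF') hFc'.mul_left
          (k3 _ hF' hFc')
        convert this using 2 with z
        push_cast
        ring
    · intro p _
      obtain ⟨W, hW, hWS⟩ := hloc p
      obtain ⟨χ, h1, h2, h3, h4⟩ := exists_contDiff_eventuallyEq_one hW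
      refine ⟨{z | χ z = 1}, mem_nhdsWithin_of_mem_nhds h4, χ, h1, fun z hz => hz,
        fun F hF hFc => ?_⟩
      refine hWS _ ((Complex.ofRealCLM.contDiff.comp h1).mul hF) hFc.mul_left ?_
      refine (closure_mono fun z hz => ?_).trans h3
      intro h0
      exact hz (by simp [h0])
  obtain ⟨χ, -, h2, h3⟩ := hcut
  have := h3 G hG hGc
  convert this using 1
  funext z
  by_cases hz : z ∈ tsupport G
  · rw [h2 z hz, Complex.ofReal_one, one_mul]
  · rw [image_eq_zero_of_notMem_tsupport hz, mul_zero]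

/-! Sublevel sets of a smooth nonnegative function. -/

/-- On the compact set `closure {H < δ} \ O`, if nonempty, `H` has a positive minimum; `ε` is taken
below it and below `δ`. -/
theorem exists_sublevel_subset {H : ℂ → ℝ} (hH : Continuous H) (hH0 : ∀ z, 0 ≤ H z)
    {δ : ℝ} (hδ : 0 < δ) (hb : Bornology.IsBounded {z | H z < δ}) {O : Set ℂ} (hO : IsOpen O)
    (hsub : H ⁻¹' {0} ⊆ O) : ∃ ε > 0, {z | H z ≤ ε} ⊆ O := by
  have hC : IsCompact (closure {z | H z < δ} \ O) := hb.isCompact_closure.diff hO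
  rcases (closure {z | H z < δ} \ O).eq_empty_or_nonempty with he | hne
  · refine ⟨δ / 2, half_pos hδ, fun z hz => ?_⟩
    have hz' : z ∈ closure {z | H z < δ} := subset_closure (lt_of_le_of_lt hz (half_lt_self hδ))
    by_contra hzO
    exact (Set.ext_iff.1 he z).1 ⟨hz', hzO⟩
  · obtain ⟨w, hw, hmin⟩ := hC.exists_isMinOn hne hH.continuousOn
    have hw0 : 0 < H w := (hH0 w).lt_of_ne fun h => hw.2 (hsub h.symm)
    refine ⟨min (δ / 2) (H w / 2), lt_min (half_pos hδ) (half_pos hw0), fun z hz => ?_⟩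
    have hz1 : H z < δ := (hz.trans (min_le_left _ _)).trans_lt (half_lt_self hδ)
    have hz2 : H z < H w := (hz.trans (min_le_right _ _)).trans_lt (half_lt_self hw0)
    by_contra hzO
    exact hz2.not_ge (hmin ⟨subset_closure hz1, hzO⟩)

/-- A point of the level set outside the closure of `{H < t}` would be a local minimum of `H`, hence
critical. -/
theorem frontier_sublevel_of_regular {H : ℂ → ℝ} (hH : Continuous H) {t : ℝ}
    (hreg : ∀ z, H z = t → fderiv ℝ H z ≠ 0) : frontier {z | H z < t} = H ⁻¹' {t} := by
  refine Set.Subset.antisymm (frontier_lt_subset_eq hH continuous_const) fun z hz => ?_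
  have hz' : H z = t := hz
  rw [(isOpen_lt hH continuous_const).frontier_eq]
  refine ⟨?_, fun h => h.ne hz'⟩
  by_contra hcl
  refine hreg z hz' (IsLocalMin.fderiv_eq_zero ?_)
  filter_upwards [isClosed_closure.isOpen_compl.mem_nhds hcl] with w hw
  rw [hz']
  exact not_lt.1 fun h => hw (subset_closure h)

theorem isSmoothDomain_sublevel {H : ℂ → ℝ} (hH : ContDiff ℝ ∞ H) {t : ℝ}
    (hb : Bornology.IsBounded {z | H z < t}) (hreg : ∀ z, H z = t → fderiv ℝ H z ≠ 0) :
    IsSmoothDomain {z | H z < t} where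
  isOpen := isOpen_lt hH.continuous continuous_const
  isBounded := hb
  smooth_boundary p hp := by
    rw [frontier_sublevel_of_regular hH.continuous hreg] at hp
    refine ⟨fun z => H z - t, sub_eq_zero.2 hp, ?_, Set.univ, isOpen_univ, trivial,
      (hH.sub contDiff_const).contDiffOn, fun z _ => (sub_neg (a := H z) (b := t)).symm⟩
    rw [gradient, fderiv_sub_const]
    exact fun h => hreg p hp ((map_eq_zero_iff _ (LinearIsometryEquiv.injective _)).1 h)

/-! The integrands near the spectrum. -/

theorem exists_cutoff {C O : Set ℂ} (hC : IsCompact C) (hO : IsOpen O) (hCO : C ⊆ O) :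
    ∃ χ : ℂ → ℝ, ContDiff ℝ 1 χ ∧ HasCompactSupport χ ∧ tsupport χ ⊆ O ∧
      ∀ z ∈ C, ∀ᶠ w in 𝓝 z, χ w = 1 := by
  obtain ⟨K, hK, hCK, hKO⟩ := exists_compact_between hC hO hCO
  obtain ⟨χ, h0, h1, -⟩ := exists_contMDiffMap_zero_one_nhds_of_isClosed 𝓘(ℝ, ℂ) (n := 1)
    isOpen_interior.isClosed_compl hC.isClosed
    (Set.disjoint_left.2 fun z hz hzC => hz (hCK hzC))
  have hsupp : tsupport χ ⊆ K := closure_minimal (fun z hz => by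
    by_contra hzK
    exact hz (h0.self_of_nhdsSet z fun h => hzK (interior_subset h))) hK.isClosed
  exact ⟨χ, χ.contMDiff.contDiff, hK.of_isClosed_subset (isClosed_tsupport _) hsupp,
    hsupp.trans hKO, fun z hz => eventually_nhdsSet_iff_forall.1 h1 z hz⟩

/-- Product rule, the other term being killed by the Cauchy–Riemann equation for `h`. -/
theorem dbar_mul_of_differentiableAt {f h : ℂ → ℂ} {z : ℂ} (hf : DifferentiableAt ℝ f z)
    (hh : DifferentiableAt ℂ h z) : dbar (fun z => f z * h z) z = dbar f z * h z := by
  have hI : fderiv ℝ h z Complex.I = Complex.I * fderiv ℝ h z 1 := by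
    rw [hh.fderiv_restrictScalars ℝ]
    simp only [ContinuousLinearMap.coe_restrictScalars']
    rw [← smul_eq_mul, ← map_smul, smul_eq_mul, mul_one]
  rw [dbar, dbar, fderiv_fun_mul hf (hh.restrictScalars ℝ)]
  simp only [add_apply, smul_apply, smul_eq_mul, hI]
  linear_combination f z * fderiv ℝ h z 1 / 2 * Complex.I_mul_I

theorem dbar_congr {f g : ℂ → ℂ} {z : ℂ} (h : f =ᶠ[𝓝 z] g) : dbar f z = dbar g z := by
  rw [dbar, dbar, h.fderiv_eq]

theorem continuousOn_dbar {f : ℂ → ℂ} {U : Set ℂ} (hU : IsOpen U) (hf : ContDiffOn ℝ ∞ f U) :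
    ContinuousOn (dbar f) U := by
  have h := hf.continuousOn_fderiv_of_isOpen hU (by simp)
  unfold dbar
  fun_prop

section Resolvent

variable {X : Type*} [NormedRing X] [NormedAlgebra ℂ X] [CompleteSpace X]

theorem differentiableOn_dual_resolvent (x : X) (Λ : StrongDual ℂ X) :
    DifferentiableOn ℂ (fun z => Λ (resolvent x z)) (spectrum ℂ x)ᶜ := fun z hz =>
  (Λ.differentiableAt.comp z (spectrum.hasDerivAt_resolvent_const_left (spectrum.notMem_iff.1 hz :
    z ∈ resolventSet ℂ x)).differentiableAt).differentiableWithinAt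

/-- Stokes' theorem between two admissible contours, one inside the other. -/
theorem IsAdmissible.contourIntegral_eq {x : X} {f : ℂ → ℂ} {U D D' : Set ℂ}
    (hf : IsSmoothNearSpectrum x f U) (hD : IsAdmissible x U D) (hD' : IsAdmissible x D D')
    (Λ : StrongDual ℂ X) :
    IntegrableOn (fun z => f z * Λ (resolvent x z) * unitTangent D z) (frontier D)
        (μH[1] : Measure ℂ) ∧
      contourIntegral D' (fun z => f z * Λ (resolvent x z)) =
        contourIntegral D (fun z => f z * Λ (resolvent x z)) -
          2 * Complex.I * ∫ z in D \ D', dbar f z * Λ (resolvent x z) := by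
  set g : ℂ → ℂ := fun z => f z * Λ (resolvent x z) with hg
  have hO : IsOpen (U \ spectrum ℂ x) := hf.isOpen.sdiff (spectrum.isClosed x)
  have hDo := hD.isSmoothDomain.isOpen
  have hDo' := hD'.isSmoothDomain.isOpen
  have hDD : D' ⊆ D := subset_closure.trans hD'.closure_subset
  -- The cutoff is `1` near `closure D \ D'` and supported in `U \ σ(x)`, so `χ f Λ(R_x)` is `C¹` on
  -- the whole plane. Stokes applies to it on `D` and on `D'` separately; what the cutoff alters
  -- inside `D'` cancels in the difference.
  obtain ⟨χ, hχ, hχc, hχO, hχ1⟩ := exists_cutoff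
    (hD.isSmoothDomain.isBounded.isCompact_closure.diff hDo') hO
    (Set.sdiff_subset_sdiff hD.closure_subset hD'.spectrum_subset)
  have hres : ∀ z ∉ spectrum ℂ x, DifferentiableAt ℂ (fun z => Λ (resolvent x z)) z := fun z hz =>
    (differentiableOn_dual_resolvent x Λ).differentiableAt
      ((spectrum.isClosed x).isOpen_compl.mem_nhds hz)
  have hresc : ContDiffOn ℝ 1 (fun z => Λ (resolvent x z)) (spectrum ℂ x)ᶜ :=
    ((differentiableOn_dual_resolvent x Λ).contDiffOn
      (spectrum.isClosed x).isOpen_compl).restrict_scalars ℝ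
  have hfz : ∀ z ∈ U, ContDiffAt ℝ 1 f z := fun z hz =>
    (hf.contDiffOn.contDiffAt (hf.isOpen.mem_nhds hz)).of_le (by simp)
  set G : ℂ → ℂ := fun z => (χ z : ℂ) * g z with hGdef
  have hts : tsupport (fun z => ((χ z : ℝ) : ℂ)) ⊆ tsupport χ :=
    closure_mono fun z hz h0 => hz (by simp [h0])
  have hχC : HasCompactSupport fun z => ((χ z : ℝ) : ℂ) :=
    hχc.isCompact.of_isClosed_subset (isClosed_tsupport _) hts
  have hG : ContDiff ℝ 1 G := by
    refine contDiff_mul_of_tsupport (Complex.ofRealCLM.contDiff.comp hχ) fun z hz => ?_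
    have hz' := hχO (hts hz)
    exact (hfz z hz'.1).mul (hresc.contDiffAt ((spectrum.isClosed x).isOpen_compl.mem_nhds hz'.2))
  have hGc : HasCompactSupport G := hχC.mul_right
  have hGg : ∀ z ∈ closure D \ D', G =ᶠ[𝓝 z] g := fun z hz => by
    filter_upwards [hχ1 z hz] with w hw
    simp only [hGdef, hw, Complex.ofReal_one, one_mul]
  have hfr : frontier D ⊆ closure D \ D' := fun z hz => by
    rw [hDo.frontier_eq] at hz
    exact ⟨hz.1, fun h => hz.2 (hDD h)⟩
  have hfr' : frontier D' ⊆ closure D \ D' := fun z hz => by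
    rw [hDo'.frontier_eq] at hz
    exact ⟨subset_closure (hD'.closure_subset hz.1), hz.2⟩
  have hdb : ∀ z ∈ D \ D', dbar G z = dbar f z * Λ (resolvent x z) := fun z hz => by
    rw [dbar_congr (hGg z ⟨subset_closure hz.1, hz.2⟩)]
    exact dbar_mul_of_differentiableAt
      ((hfz z (hD.closure_subset (subset_closure hz.1))).differentiableAt one_ne_zero)
      (hres z fun h => hz.2 (hD'.spectrum_subset h))
  obtain ⟨i1, e1⟩ := hD.isSmoothDomain.hasStokes hG hGc
  obtain ⟨-, e2⟩ := hD'.isSmoothDomain.hasStokes hG hGc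
  have hcontour : ∀ {A : Set ℂ}, frontier A ⊆ closure D \ D' →
      contourIntegral A G = contourIntegral A g := fun hA =>
    setIntegral_congr_fun isClosed_frontier.measurableSet fun z hz => by
      simp only [(hGg z (hA hz)).self_of_nhds]
  refine ⟨i1.congr_fun (fun z hz => ?_) isClosed_frontier.measurableSet, ?_⟩
  · simp only [(hGg z (hfr hz)).self_of_nhds, hg]
  · rw [hcontour hfr] at e1
    rw [hcontour hfr'] at e2
    rw [e1, e2, ← setIntegral_congr_fun (hDo.measurableSet.diff hDo'.measurableSet) hdb,
      setIntegral_sdiff hDo'.measurableSet (integrable_dbar hG hGc).integrableOn hDD]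
    ring

/-- The factor `dbar f` is bounded on the compact closure of `D`; the other is integrable by
regularity of `x`, applied to `D` itself. -/
theorem IsAdmissible.integrableOn_dbar_mul_resolvent {x : X} (hx : IsRegularElement x)
    {f : ℂ → ℂ} {U D : Set ℂ} (hf : IsSmoothNearSpectrum x f U) (hD : IsAdmissible x U D)
    (Λ : StrongDual ℂ X) :
    IntegrableOn (fun z => dbar f z * Λ (resolvent x z)) (D \ spectrum ℂ x) := by
  have hc := hD.isSmoothDomain.isBounded.isCompact_closure
  have hcont := continuousOn_dbar hf.isOpen hf.contDiffOn
  obtain ⟨C, hC⟩ := hc.exists_bound_of_continuousOn (hcont.mono hD.closure_subset)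
  have hm : MeasurableSet (D \ spectrum ℂ x) :=
    hD.isSmoothDomain.isOpen.measurableSet.diff (spectrum.isClosed x).measurableSet
  have hsub : D \ spectrum ℂ x ⊆ closure D := Set.sdiff_subset.trans subset_closure
  refine (hx D hD.isSmoothDomain.isOpen hc hD.spectrum_subset Λ).bdd_mul (c := C)
    ((hcont.mono (hsub.trans hD.closure_subset)).aestronglyMeasurable hm) ?_
  exact (ae_restrict_iff' hm).2 (Eventually.of_forall fun z hz => hC z (hsub hz))

end Resolvent

/-- Dominated convergence with bound `‖h‖`: a point with `H z > 0` eventually leaves the sublevel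
sets `{H < t n}`. -/
theorem tendsto_setIntegral_diff_sublevel {H : ℂ → ℝ} (hH : Continuous H) (hH0 : ∀ z, 0 ≤ H z)
    {t : ℕ → ℝ} (ht : ∀ n, 0 < t n) (hlim : Tendsto t atTop (𝓝 0)) {D : Set ℂ} {h : ℂ → ℂ}
    (hh : IntegrableOn h (D \ H ⁻¹' {0})) (hD : MeasurableSet D) :
    Tendsto (fun n => ∫ z in D \ {z | H z < t n}, h z) atTop (𝓝 (∫ z in D \ H ⁻¹' {0}, h z)) := by
  have hmt : ∀ n, MeasurableSet {z | H z < t n}ᶜ := fun n =>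
    (isOpen_lt hH continuous_const).measurableSet.compl
  have hmD : MeasurableSet (D \ H ⁻¹' {0}) :=
    hD.diff (hH.measurable (measurableSet_singleton 0))
  have heq : ∀ n, ∫ z in D \ {z | H z < t n}, h z =
      ∫ z in D \ H ⁻¹' {0}, {z | H z < t n}ᶜ.indicator h z := fun n => by
    rw [setIntegral_indicator (hmt n)]
    congr 2
    ext z
    constructor
    · exact fun hz => ⟨⟨hz.1, fun h0 => hz.2 ((show H z = 0 from h0).trans_lt (ht n))⟩, hz.2⟩
    · exact fun hz => ⟨hz.1.1, hz.2⟩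
  simp_rw [heq]
  refine tendsto_integral_of_dominated_convergence (fun z => ‖h z‖)
    (fun n => hh.aestronglyMeasurable.indicator (hmt n)) hh.norm
    (fun n => Eventually.of_forall fun z => norm_indicator_le_norm_self _ _) ?_
  refine (ae_restrict_iff' hmD).2 (Eventually.of_forall fun z hz => ?_)
  have hz0 : 0 < H z := (hH0 z).lt_of_ne fun h0 => hz.2 h0.symm
  refine tendsto_const_nhds.congr' ?_
  filter_upwards [hlim.eventually_lt_const hz0] with n hn
  rw [Set.indicator_of_mem]
  exact fun h => absurd h hn.not_gt

end SmoothCalculus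

end

/-! ### The smooth calculus as a limit of contour integrals. -/

theorem mainTheorem4 {X : Type*} [NormedRing X] [NormedAlgebra ℂ X] [CompleteSpace X]
    (x : X) (hx : SmoothCalculus.IsRegularElement x)
    (f : ℂ → ℂ) (U : Set ℂ) (hf : SmoothCalculus.IsSmoothNearSpectrum x f U)
    (H : ℂ → ℝ) (hH : ContDiff ℝ ∞ H) (hH_nonneg : ∀ z, 0 ≤ H z)
    (hH_zero : H ⁻¹' {0} = spectrum ℂ x)
    (hH_bounded : ∃ δ > 0, Bornology.IsBounded {z | H z < δ})
    (t : ℕ → ℝ) (ht_pos : ∀ n, 0 < t n) (ht_lim : Tendsto t atTop (𝓝 0))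
    (ht_regular : ∀ n z, H z = t n → fderiv ℝ H z ≠ 0) :
    (∀ᶠ n in atTop, SmoothCalculus.IsAdmissible x U {z | H z < t n} ∧
      frontier {z | H z < t n} = H ⁻¹' {t n}) ∧
    ∀ D : Set ℂ, SmoothCalculus.IsAdmissible x U D →
      SmoothCalculus.DunfordIntegrable (SmoothCalculus.contourIntegrand x f D)
        ((μH[1] : Measure ℂ).restrict (frontier D)) ∧
      SmoothCalculus.DunfordIntegrable (SmoothCalculus.areaIntegrand x f)
        ((volume : Measure ℂ).restrict (D \ spectrum ℂ x)) ∧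
      ∀ Λ : StrongDual ℂ X, ∃ L : ℂ,
        Tendsto (fun n => SmoothCalculus.contourIntegral {z | H z < t n}
          (fun z => f z * Λ (resolvent x z))) atTop (𝓝 L) ∧
        SmoothCalculus.smoothCalculus x f D Λ = 1 / (2 * (Real.pi : ℂ) * Complex.I) * L := by
  obtain ⟨δ, hδ, hb⟩ := hH_bounded
  -- Used with `O = U` for the first claim, and with `O = D` to place the contours inside a given
  -- one.
  have hadm : ∀ O : Set ℂ, IsOpen O → spectrum ℂ x ⊆ O →
      ∀ᶠ n in atTop, SmoothCalculus.IsAdmissible x O {z | H z < t n} := by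
    intro O hO hsub
    obtain ⟨ε, hε, hεO⟩ := SmoothCalculus.exists_sublevel_subset hH.continuous hH_nonneg hδ hb hO
      (hH_zero.trans_subset hsub)
    filter_upwards [ht_lim.eventually_lt_const hδ, ht_lim.eventually_lt_const hε] with n h1 h2
    refine ⟨SmoothCalculus.isSmoothDomain_sublevel hH
      (hb.subset fun z (hz : H z < t n) => hz.trans h1) (ht_regular n), ?_, ?_⟩
    · rw [← hH_zero]
      exact fun z hz => (show H z = 0 from hz).trans_lt (ht_pos n)
    · exact (closure_lt_subset_le hH.continuous continuous_const).trans fun z hz =>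
        hεO ((show H z ≤ t n from hz).trans h2.le)
  refine ⟨?_, fun D hD => ?_⟩
  · filter_upwards [hadm U hf.isOpen hf.spectrum_subset] with n hn
    exact ⟨hn, SmoothCalculus.frontier_sublevel_of_regular hH.continuous (ht_regular n)⟩
  have hDo := hD.isSmoothDomain.isOpen
  have hev := hadm D hDo hD.spectrum_subset
  -- One inner contour is enough to obtain integrability on `∂D` from
  -- `IsAdmissible.contourIntegral_eq`.
  obtain ⟨n₀, hn₀⟩ := hev.exists
  have hci : ∀ (Λ : StrongDual ℂ X) z, Λ (SmoothCalculus.contourIntegrand x f D z) =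
      f z * Λ (resolvent x z) * SmoothCalculus.unitTangent D z := fun Λ z => by
    rw [SmoothCalculus.contourIntegrand, map_smul, smul_eq_mul]; ring
  have hai : ∀ (Λ : StrongDual ℂ X) z, Λ (SmoothCalculus.areaIntegrand x f z) =
      SmoothCalculus.dbar f z * Λ (resolvent x z) := fun Λ z => by
    rw [SmoothCalculus.areaIntegrand, map_smul, smul_eq_mul]
  have hc : SmoothCalculus.DunfordIntegrable (SmoothCalculus.contourIntegrand x f D)
      ((μH[1] : Measure ℂ).restrict (frontier D)) := fun Λ => by
    simp only [hci]
    exact (hD.contourIntegral_eq hf hn₀ Λ).1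
  have ha : SmoothCalculus.DunfordIntegrable (SmoothCalculus.areaIntegrand x f)
      ((volume : Measure ℂ).restrict (D \ spectrum ℂ x)) := fun Λ => by
    simp only [hai]
    exact hD.integrableOn_dbar_mul_resolvent hx hf Λ
  -- The limit is the right side of Stokes' formula with `σ(x)` in place of `Ω_n`; the coefficients
  -- match since `2i / (2πi) = 1/π`.
  refine ⟨hc, ha, fun Λ => ⟨SmoothCalculus.contourIntegral D (fun z => f z * Λ (resolvent x z)) -
    2 * Complex.I * ∫ z in D \ spectrum ℂ x, SmoothCalculus.dbar f z * Λ (resolvent x z), ?_, ?_⟩⟩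
  · have hint := hD.integrableOn_dbar_mul_resolvent hx hf Λ
    rw [← hH_zero] at hint ⊢
    have hlim := SmoothCalculus.tendsto_setIntegral_diff_sublevel hH.continuous hH_nonneg ht_pos
      ht_lim hint hDo.measurableSet
    refine Tendsto.congr' ?_ (tendsto_const_nhds.sub (hlim.const_mul (2 * Complex.I)))
    filter_upwards [hev] with n hn
    exact (hD.contourIntegral_eq hf hn Λ).2.symm
  · have hπ : (Real.pi : ℂ) ≠ 0 := Complex.ofReal_ne_zero.2 Real.pi_ne_zero
    have hI := Complex.I_ne_zero
    rw [SmoothCalculus.smoothCalculus, sub_apply, smul_apply, smul_apply,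
      SmoothCalculus.dunfordIntegral_apply hc, SmoothCalculus.dunfordIntegral_apply ha]
    simp only [hci, hai, smul_eq_mul, SmoothCalculus.contourIntegral]
    field_simp
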